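/- Let $\mathbb S_\infty=\{z\in\mathbb C:\operatorname{Im}z>0\}$. For a function $F$ on $\mathbb S_\infty$ write $F^*(p)=\lim_{\varepsilon\to0^+}F(p+i\varepsilon)$, $p\in\mathbb R$, where this limit exists. An inner function on $\mathbb S_\infty$ is a bounded holomorphic function $\varphi$ on $\mathbb S_\infty$ such that $\varphi^*(p)$ exists with $|\varphi^*(p)|=1$ for almost all $p\in\mathbb R$; it is symmetric if $\varphi^*(-p)=\overline{\varphi^*(p)}$ for almost all $p\in\mathbb R$. A one-parameter semigroup of symmetric inner functions is a family $(\varphi_t)_{t\ge0}$ of symmetric inner functions on $\mathbb S_\infty$ with $\varphi_{s+t}=\varphi_s\varphi_t$ for $s,t\ge0$ and with $t\mapsto\varphi_t^*$ weak$^*$-continuous from $[0,\infty)$ to $L^\infty(\mathbb R,dp)$. (i) Let $(\varphi_t)_{t\ge0}$ be a one-parameter semigroup of symmetric inner functions. Then there is a holomorphic function $f$ on $\mathbb S_\infty$ with $\operatorname{Im}f\ge0$ such that $\varphi_t(z)=e^{itf(z)}$ for all $t\ge0$ and $z\in\mathbb S_\infty$. For almost all $p\in\mathbb R$ the limit $f^*(p)$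 exists, is real, and satisfies $f^*(-p)=-f^*(p)$. Moreover there are a constant $c\ge0$ and a positive measure $\nu$ on $[0,\infty)$, with $(1+\lambda^2)^{-1}\nu$ finite and singular with respect to the Lebesgue measure, such that for almost all $p\ge0$ $$f^*(p)=cp+\mathrm{p.v.}\!\int_{[0,\infty)}\frac{p}{\lambda^2-p^2}\,d\nu(\lambda) :=\lim_{\delta\to0^+}\Bigl(cp+\int_{\{\lambda\ge0,\ |\lambda-p|>\delta\}}\frac{p}{\lambda^2-p^2}\,d\nu(\lambda)\Bigr).\qquad(*)$$ (ii) Conversely, let $c\ge0$ and let $\nu$ be a positive measure on $[0,\infty)$ such that $(1+\lambda^2)^{-1}\nu$ is finite and singular with respect to the Lebesgue measure. Then the right-hand side of $(*)$ exists for almost all $p\ge0$ and is the boundary function $f^*$ of a holomorphic function $f$ on $\mathbb S_\infty$ with $\operatorname{Im}f\ge0$ whose boundary values $f^*(p)$ exist, are real and satisfy $f^*(-p)=-f^*(p)$ for almost all $p\in\mathbb R$; and for every such $f$ the family $\varphi_t=e^{itf}$, $t\ge0$, is a one-parameter semigroup of symmetric inner functions on $\mathbb S_\infty$. -/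

import Mathlib

open Filter Topology MeasureTheory
open scoped NNReal ENNReal ComplexConjugate

namespace InnerSemigroup

/- Functions on the open upper half-plane are written as functions on `ℂ` whose values outside
`UpperHalfPlane.upperHalfPlaneSet = {z | 0 < z.im}` play no role. -/
/-- `F (p + i ε) → w` as `ε → 0⁺`. -/
def HasBoundaryLimit (F : ℂ → ℂ) (p : ℝ) (w : ℂ) : Prop :=
  Tendsto (fun ε : ℝ => F ((p : ℂ) + (ε : ℂ) * Complex.I)) (𝓝[>] (0 : ℝ)) (𝓝 w)

/-- The boundary function `F* p = lim_{ε → 0⁺} F (p + i ε)` (an arbitrary value where the limit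
does not exist; existence is always asserted separately by `HasBoundaryLimit`). -/
noncomputable def boundaryValue (F : ℂ → ℂ) (p : ℝ) : ℂ :=
  limUnder (𝓝[>] (0 : ℝ)) (fun ε : ℝ => F ((p : ℂ) + (ε : ℂ) * Complex.I))

/-- Inner functions on the upper half-plane: bounded holomorphic functions whose boundary
values exist and have modulus one almost everywhere. -/
structure IsInner (φ : ℂ → ℂ) : Prop where
  holomorphic : DifferentiableOn ℂ φ UpperHalfPlane.upperHalfPlaneSet
  bounded : ∃ M : ℝ, ∀ z ∈ UpperHalfPlane.upperHalfPlaneSet, ‖φ z‖ ≤ M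
  boundary_limit : ∀ᵐ p : ℝ, HasBoundaryLimit φ p (boundaryValue φ p)
  boundary_norm : ∀ᵐ p : ℝ, ‖boundaryValue φ p‖ = 1

/-- Symmetry: `φ* (-p) = conj (φ* p)` for almost all real `p`. -/
def IsSymmetric (φ : ℂ → ℂ) : Prop :=
  ∀ᵐ p : ℝ, boundaryValue φ (-p) = conj (boundaryValue φ p)

/-- One-parameter semigroups of symmetric inner functions, with `t ↦ φ_t*` continuous for the
weak-* topology of `L^∞(ℝ)`, i.e. against every function in `L¹(ℝ)`. -/
structure IsSymmetricInnerSemigroup (φ : ℝ≥0 → ℂ → ℂ) : Prop where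
  inner : ∀ t, IsInner (φ t)
  symmetric : ∀ t, IsSymmetric (φ t)
  add : ∀ s t, ∀ z ∈ UpperHalfPlane.upperHalfPlaneSet, φ (s + t) z = φ s z * φ t z
  weakStar_continuous : ∀ g : ℝ → ℂ, Integrable g →
    Continuous (fun t : ℝ≥0 => ∫ p : ℝ, boundaryValue (φ t) p * g p)

/-- `ν` is a (positive) measure on `[0, ∞)` such that `(1 + x²)⁻¹ ν` is finite and singular with
respect to the Lebesgue measure. -/
structure IsGeneratorMeasure (ν : Measure ℝ) : Prop where
  support : ν (Set.Iio 0) = 0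
  finite : IsFiniteMeasure (ν.withDensity (fun x : ℝ => ENNReal.ofReal (1 + x ^ 2)⁻¹))
  singular : (ν.withDensity (fun x : ℝ => ENNReal.ofReal (1 + x ^ 2)⁻¹)) ⟂ₘ volume

/-- `y = c p + p.v. ∫_{[0,∞)} p / (x² - p²) dν(x)`, a Cauchy principal value at `x = p`; the
truncated integrals converge absolutely for `p > 0` if `(1 + x²)⁻¹ ν` is finite. -/
def IsGeneratorValue (c : ℝ) (ν : Measure ℝ) (p y : ℝ) : Prop :=
  Tendsto (fun δ : ℝ => c * p + ∫ x in {x : ℝ | 0 ≤ x ∧ δ < |x - p|}, p / (x ^ 2 - p ^ 2) ∂ν)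
    (𝓝[>] (0 : ℝ)) (𝓝 y)

/-- `f` is holomorphic on the upper half-plane with non-negative imaginary part, its boundary
function `f*` exists almost everywhere, is real and odd, and for almost all `p ≥ 0` it is given
by `c p + p.v. ∫ p / (x² - p²) dν(x)`. -/
structure IsGenerator (f : ℂ → ℂ) (c : ℝ) (ν : Measure ℝ) : Prop where
  holomorphic : DifferentiableOn ℂ f UpperHalfPlane.upperHalfPlaneSet
  im_nonneg : ∀ z ∈ UpperHalfPlane.upperHalfPlaneSet, 0 ≤ (f z).im
  boundary_limit : ∀ᵐ p : ℝ, HasBoundaryLimit f p (boundaryValue f p)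
  boundary_real : ∀ᵐ p : ℝ, (boundaryValue f p).im = 0
  boundary_odd : ∀ᵐ p : ℝ, boundaryValue f (-p) = -boundaryValue f p
  boundary_formula : ∀ᵐ p : ℝ, 0 ≤ p → IsGeneratorValue c ν p (boundaryValue f p).re

end InnerSemigroup

/-! From semigroup to exponent: an inner function is the Poisson integral of its boundary function,
hence bounded by one, and weak-* continuity tested against the Poisson kernel makes `t ↦ φ_t(z)`
continuous for each `z`. A bounded continuous semigroup of scalars is an exponential whose exponent
is `1 - 1/R`, with `R` its Laplace transform at 1 (`eq_exp_of_continuous_semigroup`). Since `R`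
depends holomorphically on `z`, so does the generator `f`; the bound `‖φ_1‖ ≤ 1` gives `Im f ≥ 0`,
and symmetry gives `f(-z̄) = -conj f(z)`.

From exponent to measure: the Herglotz theorem, transported from the disc by the Cayley map,
represents `Im f` by a finite measure. Symmetry folds this measure onto `[0, ∞)`, so that `f(z) = c
z + ∫ z(1+x²)/(x²-z²) dm(x)` (`exists_symmetricHerglotz`), and `ν = (1+x²) m`. By differentiation of
measures, `m` is singular exactly when `Im f` tends to 0 at almost every boundary point; since `Im f
= -log|φ_1|`, unimodular boundary values of `φ_1` say just this.

Boundary values of `f`: Fatou's theorem gives limits of the bounded function `e^{if}`. Once `Im f →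
0`, this means that `e^{i Re f}` converges on the unit circle, and a continuous real function along
the vertical ray whose image on the circle converges must itself converge
(`exists_tendsto_of_tendsto_exp`). The principal value comes out by comparison: at height `δ`, the
real part of the kernel and the kernel truncated at `|x - p| > δ` differ by at most three times the
imaginary part of the kernel, which integrates to something vanishing
(`abs_symmetricKernel_re_sub_le`).

Conversely, for given `c` and `ν` the Herglotz integral is a generator by the same arguments, and
the semigroup properties of `e^{itf}` are read off the real, odd boundary function. -/

namespace InnerSemigroup

open Complex

/-! ### Poisson formula for bounded holomorphic functions -/

/-- The Poisson kernel of the upper half-plane. -/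
noncomputable def halfPlanePoisson (z : ℂ) (t : ℝ) : ℝ := Real.pi⁻¹ * z.im * ((t - z.re) ^ 2 + z.im ^ 2)⁻¹

lemma halfPlanePoisson_nonneg {z : ℂ} (hz : 0 < z.im) (t : ℝ) : 0 ≤ halfPlanePoisson z t := by
  unfold halfPlanePoisson; positivity

lemma continuous_halfPlanePoisson {z : ℂ} (hz : 0 < z.im) : Continuous (halfPlanePoisson z) := by
  unfold halfPlanePoisson
  have : ∀ t : ℝ, (t - z.re) ^ 2 + z.im ^ 2 ≠ 0 := fun t => by positivity
  fun_prop (disch := assumption)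

/-- Integrability and total mass one are inherited from the Cauchy distribution. -/
lemma halfPlanePoisson_eq_cauchyPDFReal {z : ℂ} (hz : 0 < z.im) :
    halfPlanePoisson z = ProbabilityTheory.cauchyPDFReal z.re z.im.toNNReal := by
  ext t
  rw [ProbabilityTheory.cauchyPDFReal_def, Real.coe_toNNReal _ hz.le, halfPlanePoisson]

lemma integrable_halfPlanePoisson {z : ℂ} (hz : 0 < z.im) : Integrable (halfPlanePoisson z) := by
  rw [halfPlanePoisson_eq_cauchyPDFReal hz]
  exact ProbabilityTheory.integrable_cauchyPDFReal _

lemma integral_halfPlanePoisson {z : ℂ} (hz : 0 < z.im) : ∫ t, halfPlanePoisson z t = 1 := by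
  rw [halfPlanePoisson_eq_cauchyPDFReal hz]
  exact ProbabilityTheory.integral_cauchyPDFReal_eq_one _ (by simpa using hz)

lemma ofReal_sub_mul_ofReal_sub_conj (z : ℂ) (t : ℝ) :
    ((t : ℂ) - z) * (t - conj z) = (((t - z.re) ^ 2 + z.im ^ 2 : ℝ) : ℂ) := by
  apply Complex.ext <;> simp [pow_two]; ring

/-- The integral over a line of a holomorphic function which decays quadratically in the upper
half-plane vanishes. -/
lemma integral_eq_zero_of_quadratic_decay {h : ℂ → ℂ} {C R₀ : ℝ}
    (hd : DifferentiableOn ℂ h {ζ | 0 ≤ ζ.im})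
    (hb : ∀ ζ : ℂ, 0 ≤ ζ.im → R₀ ≤ ‖ζ‖ → ‖h ζ‖ ≤ C / ‖ζ‖ ^ 2)
    (hi : Integrable fun t : ℝ => h t) : ∫ t : ℝ, h t = 0 := by
  -- Cauchy's theorem on the rectangle `[-R, R] × [0, R]`: the three sides off the real line have
  -- total length `4R`, and the integrand there is at most `C / R²`.
  have hC : ∀ R : ℝ, 0 < R → R₀ ≤ R → ‖∫ t in (-R)..R, h t‖ ≤ 4 * C / R := by
    intro R hR hR0
    have key := Complex.integral_boundary_rect_eq_zero_of_differentiableOn h (-R : ℂ) (R + R * I)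
      (hd.mono (by
        rintro ζ ⟨-, h2⟩
        simp only [Set.mem_preimage, neg_im, ofReal_im, neg_zero, add_im, mul_im, ofReal_re, I_im,
          mul_one, I_re, mul_zero, add_zero, zero_add, Set.uIcc_of_le hR.le] at h2
        exact h2.1))
    simp only [neg_im, ofReal_im, neg_zero, add_im, mul_im, ofReal_re, I_im, mul_one, I_re,
      mul_zero, add_zero, zero_add, neg_re, add_re, mul_re, ofReal_zero, zero_mul,
      smul_eq_mul, sub_self, ofReal_neg] at key
    have bd : ∀ ζ : ℂ, 0 ≤ ζ.im → R ≤ ‖ζ‖ → ‖h ζ‖ ≤ C / R ^ 2 := by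
      intro ζ h1 h2
      refine (hb ζ h1 (hR0.trans h2)).trans ?_
      have : 0 ≤ C := by
        have := (norm_nonneg _).trans (hb ζ h1 (hR0.trans h2))
        by_contra hneg
        have h3 : 0 < ‖ζ‖ := hR.trans_le h2
        exact absurd this (not_le.2 (div_neg_of_neg_of_pos (not_le.1 hneg) (by positivity)))
      gcongr
    have b1 : ‖∫ x in (-R)..R, h (x + R * I)‖ ≤ C / R ^ 2 * |R - -R| := by
      refine intervalIntegral.norm_integral_le_of_norm_le_const fun x _ => bd _ (by simp [hR.le]) ?_
      simpa [abs_of_pos hR] using abs_im_le_norm (x + R * I : ℂ)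
    have b2 : ‖∫ y in (0 : ℝ)..R, h (R + y * I)‖ ≤ C / R ^ 2 * |R - 0| := by
      refine intervalIntegral.norm_integral_le_of_norm_le_const fun y hy => bd _ ?_ ?_
      · rw [Set.uIoc_of_le hR.le] at hy; simpa using hy.1.le
      · simpa [abs_of_pos hR] using abs_re_le_norm (R + y * I : ℂ)
    have b3 : ‖∫ y in (0 : ℝ)..R, h (-R + y * I)‖ ≤ C / R ^ 2 * |R - 0| := by
      refine intervalIntegral.norm_integral_le_of_norm_le_const fun y hy => bd _ ?_ ?_
      · rw [Set.uIoc_of_le hR.le] at hy; simpa using hy.1.le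
      · simpa [abs_of_pos hR] using abs_re_le_norm (-R + y * I : ℂ)
    have e : ∫ t in (-R)..R, h t = (∫ x in (-R)..R, h (x + R * I)) -
        I * (∫ y in (0 : ℝ)..R, h (R + y * I)) + I * ∫ y in (0 : ℝ)..R, h (-R + y * I) := by
      linear_combination key
    rw [e]
    refine (norm_add_le _ _).trans ((add_le_add_left (norm_sub_le _ _) _).trans ?_)
    rw [norm_mul, norm_mul, norm_I, one_mul, one_mul]
    rw [sub_neg_eq_add, abs_of_pos (by linarith)] at b1
    rw [sub_zero, abs_of_pos hR] at b2 b3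
    calc _ ≤ C / R ^ 2 * (R + R) + C / R ^ 2 * R + C / R ^ 2 * R := by gcongr
      _ = 4 * C / R := by field_simp; ring
  have l1 : Tendsto (fun R : ℝ => ∫ t in (-R)..R, h t) atTop (𝓝 (∫ t : ℝ, h t)) :=
    intervalIntegral_tendsto_integral hi tendsto_neg_atTop_atBot tendsto_id
  have l2 : Tendsto (fun R : ℝ => ∫ t in (-R)..R, h t) atTop (𝓝 0) := by
    apply squeeze_zero_norm' _ (tendsto_const_nhds.div_atTop tendsto_id : Tendsto (fun R : ℝ => 4 * C / R) atTop (𝓝 0))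
    filter_upwards [eventually_gt_atTop 0, eventually_ge_atTop R₀] with R h1 h2 using hC R h1 h2
  exact tendsto_nhds_unique l1 l2

/-- Poisson formula for bounded functions which are holomorphic across the real line. -/
lemma integral_halfPlanePoisson_mul_of_differentiableOn {F : ℂ → ℂ} {δ M : ℝ} (hδ : 0 < δ)
    (hF : DifferentiableOn ℂ F {ζ | -δ < ζ.im}) (hM : ∀ ζ : ℂ, 0 ≤ ζ.im → ‖F ζ‖ ≤ M)
    {z : ℂ} (hz : 0 < z.im) : ∫ t : ℝ, (halfPlanePoisson z t : ℂ) * F t = F z := by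
  have hM0 : 0 ≤ M := (norm_nonneg _).trans (hM z hz.le)
  have hcont : Continuous fun t : ℝ => F t := by
    refine hF.continuousOn.comp_continuous continuous_ofReal fun t => ?_
    simpa using hδ
  have hopen : IsOpen {ζ : ℂ | -δ < ζ.im} := isOpen_lt continuous_const continuous_im
  have hint : Integrable fun t : ℝ => (halfPlanePoisson z t : ℂ) * F t := by
    refine (integrable_halfPlanePoisson hz).ofReal.mul_bdd (c := M) hcont.aestronglyMeasurable ?_
    exact Eventually.of_forall fun t => hM t (by simp)
  have hne : ∀ ζ : ℂ, 0 ≤ ζ.im → ζ - conj z ≠ 0 := fun ζ hζ h0 => by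
    have := congrArg im h0
    simp at this; linarith
  have hnz : ∀ t : ℝ, (t : ℂ) ≠ z := fun t h => by rw [← h] at hz; simp at hz
  -- On the real line `(t - z)(t - z̄) = |t - z|²`, so dividing the difference quotient of `F` at
  -- `z` by `t - z̄` produces the Poisson kernel times `F t - F z`. The use of `dslope` removes the
  -- singularity at `z`.
  have hreal : ∀ t : ℝ, dslope F z t / (t - conj z) =
      (Real.pi * z.im⁻¹ : ℂ) * ((halfPlanePoisson z t : ℂ) * F t - F z * halfPlanePoisson z t) := by
    intro t
    have h1 : ((t - z.re) ^ 2 + z.im ^ 2 : ℝ) ≠ 0 := by positivity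
    rw [dslope_of_ne _ (hnz t), slope_def_field, div_div, ofReal_sub_mul_ofReal_sub_conj]
    unfold halfPlanePoisson
    have h2 : (z.im : ℂ) ≠ 0 := by exact_mod_cast hz.ne'
    have h3 : (Real.pi : ℂ) ≠ 0 := by exact_mod_cast Real.pi_ne_zero
    have h4 : (((t - z.re) ^ 2 + z.im ^ 2 : ℝ) : ℂ) ≠ 0 := by exact_mod_cast h1
    push_cast at h4 ⊢
    field_simp
  have hint2 : Integrable fun t : ℝ => F z * (halfPlanePoisson z t : ℂ) :=
    (integrable_halfPlanePoisson hz).ofReal.const_mul _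
  -- For `‖ζ‖ ≥ 2‖z‖` both `‖ζ - z‖` and `‖ζ - z̄‖` are at least `‖ζ‖ / 2`, and `‖F ζ - F z‖ ≤ 2M`;
  -- hence `8M`.
  have key := integral_eq_zero_of_quadratic_decay (h := fun ζ => dslope F z ζ / (ζ - conj z))
    (C := 8 * M) (R₀ := 2 * ‖z‖) ?_ ?_ ?_
  · simp only [hreal] at key
    rw [integral_const_mul, integral_sub hint hint2, integral_const_mul, integral_complex_ofReal,
      integral_halfPlanePoisson hz] at key
    have h2 : (z.im : ℂ) ≠ 0 := by exact_mod_cast hz.ne'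
    have h3 : (Real.pi : ℂ) ≠ 0 := by exact_mod_cast Real.pi_ne_zero
    have h5 := (mul_eq_zero.1 key).resolve_left (mul_ne_zero h3 (by exact_mod_cast inv_ne_zero h2))
    simpa [sub_eq_zero] using h5
  · have hds : DifferentiableOn ℂ (dslope F z) {ζ | -δ < ζ.im} :=
      (Complex.differentiableOn_dslope (hopen.mem_nhds (by simp; linarith))).2 hF
    refine DifferentiableOn.div (hds.mono fun ζ (hζ : 0 ≤ ζ.im) => ?_) (by fun_prop) fun ζ hζ => hne ζ hζ
    show -δ < ζ.im
    linarith
  · intro ζ h1 h2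
    have hz0 : 0 < ‖z‖ := norm_pos_iff.2 fun h => by simp [h] at hz
    have h3 : ‖ζ‖ / 2 ≤ ‖ζ - z‖ := by linarith [norm_sub_norm_le ζ z]
    have h4 : ‖ζ‖ / 2 ≤ ‖ζ - conj z‖ := by
      have := norm_sub_norm_le ζ (conj z)
      rw [Complex.norm_conj] at this; linarith
    have h5 : 0 < ‖ζ‖ := by linarith
    rw [dslope_of_ne, slope_def_field, norm_div, norm_div, div_div]
    · calc _ ≤ (2 * M) / (‖ζ‖ / 2 * (‖ζ‖ / 2)) := by
            gcongr
            linarith [norm_sub_le (F ζ) (F z), hM ζ h1, hM z hz.le]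
        _ = _ := by field_simp; ring
    · rintro rfl; linarith
  · simp only [hreal]
    exact (hint.sub hint2).const_mul _

/-- The translates `F (· + i ε)` of a bounded holomorphic function on the upper half-plane satisfy
the Poisson formula. -/
lemma integral_halfPlanePoisson_mul_translate {F : ℂ → ℂ} {M : ℝ}
    (hF : DifferentiableOn ℂ F UpperHalfPlane.upperHalfPlaneSet)
    (hM : ∀ ζ ∈ UpperHalfPlane.upperHalfPlaneSet, ‖F ζ‖ ≤ M)
    {z : ℂ} (hz : 0 < z.im) {ε : ℝ} (hε : 0 < ε) :
    ∫ t : ℝ, (halfPlanePoisson z t : ℂ) * F (t + ε * I) = F (z + ε * I) := by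
  refine integral_halfPlanePoisson_mul_of_differentiableOn (F := fun ζ => F (ζ + ε * I)) (M := M) hε
    ?_ ?_ hz
  · refine hF.comp (by fun_prop) fun ζ (hζ : -ε < ζ.im) => ?_
    show 0 < (ζ + ε * I).im
    simp; linarith
  · intro ζ hζ
    refine hM _ ?_
    show 0 < (ζ + ε * I).im
    simp; linarith

lemma continuous_vertical (z : ℂ) : Continuous fun ε : ℝ => z + (ε : ℂ) * I := by fun_prop

lemma tendsto_vertical {F : ℂ → ℂ} (hF : DifferentiableOn ℂ F UpperHalfPlane.upperHalfPlaneSet)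
    {z : ℂ} (hz : 0 < z.im) : Tendsto (fun ε : ℝ => F (z + ε * I)) (𝓝[>] 0) (𝓝 (F z)) := by
  have h1 : ContinuousAt F z :=
    (hF.differentiableAt (UpperHalfPlane.isOpen_upperHalfPlaneSet.mem_nhds hz)).continuousAt
  have h2 : Tendsto (fun ε : ℝ => z + (ε : ℂ) * I) (𝓝[>] 0) (𝓝 z) := by
    simpa using ((continuous_vertical z).tendsto 0).mono_left nhdsWithin_le_nhds
  exact h1.tendsto.comp h2

lemma HasBoundaryLimit.boundaryValue_eq {F : ℂ → ℂ} {p : ℝ} {w : ℂ} (h : HasBoundaryLimit F p w) :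
    boundaryValue F p = w := Tendsto.limUnder_eq h

lemma continuous_horizontal {F : ℂ → ℂ}
    (hF : DifferentiableOn ℂ F UpperHalfPlane.upperHalfPlaneSet) {ε : ℝ} (hε : 0 < ε) :
    Continuous fun t : ℝ => F (t + ε * I) :=
  hF.continuousOn.comp_continuous (by fun_prop) fun t => by
    show 0 < ((t : ℂ) + ε * I).im
    simpa using hε

lemma aestronglyMeasurable_boundaryValue {F : ℂ → ℂ}
    (hF : DifferentiableOn ℂ F UpperHalfPlane.upperHalfPlaneSet)
    (hl : ∀ᵐ p : ℝ, HasBoundaryLimit F p (boundaryValue F p)) :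
    AEStronglyMeasurable (boundaryValue F) := by
  have hu : Tendsto (fun n : ℕ => 1 / ((n : ℝ) + 1)) atTop (𝓝[>] 0) :=
    tendsto_nhdsWithin_iff.2 ⟨tendsto_one_div_add_atTop_nhds_zero_nat,
      Eventually.of_forall fun n => by show (0 : ℝ) < _; positivity⟩
  refine aestronglyMeasurable_of_tendsto_ae atTop
    (f := fun (n : ℕ) (t : ℝ) => F (t + ((1 / ((n : ℝ) + 1) : ℝ) : ℂ) * I)) (fun n => ?_) ?_
  · exact (continuous_horizontal hF (by positivity)).aestronglyMeasurable
  · filter_upwards [hl] with p hp using Tendsto.comp (g := fun ε : ℝ => F (p + ε * I)) hp hu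

/-- A bounded holomorphic function on the upper half-plane with boundary values almost everywhere
is the Poisson integral of its boundary function. -/
lemma integral_halfPlanePoisson_mul_boundaryValue {F : ℂ → ℂ} {M : ℝ}
    (hF : DifferentiableOn ℂ F UpperHalfPlane.upperHalfPlaneSet)
    (hM : ∀ ζ ∈ UpperHalfPlane.upperHalfPlaneSet, ‖F ζ‖ ≤ M)
    (hl : ∀ᵐ p : ℝ, HasBoundaryLimit F p (boundaryValue F p)) {z : ℂ} (hz : 0 < z.im) :
    ∫ t : ℝ, (halfPlanePoisson z t : ℂ) * boundaryValue F t = F z := by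
  have hpos : ∀ᶠ ε : ℝ in 𝓝[>] 0, 0 < ε := self_mem_nhdsWithin
  have l1 : Tendsto (fun ε : ℝ => ∫ t : ℝ, (halfPlanePoisson z t : ℂ) * F (t + ε * I)) (𝓝[>] 0)
      (𝓝 (∫ t : ℝ, (halfPlanePoisson z t : ℂ) * boundaryValue F t)) := by
    refine tendsto_integral_filter_of_dominated_convergence (fun t => halfPlanePoisson z t * M)
      ?_ ?_ ((integrable_halfPlanePoisson hz).mul_const M) ?_
    · filter_upwards [hpos] with ε hε
      exact ((continuous_ofReal.comp (continuous_halfPlanePoisson hz)).mul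
        (continuous_horizontal hF hε)).aestronglyMeasurable
    · filter_upwards [hpos] with ε hε
      refine Eventually.of_forall fun t => ?_
      rw [norm_mul, norm_real, Real.norm_of_nonneg (halfPlanePoisson_nonneg hz t)]
      refine mul_le_mul_of_nonneg_left (hM _ ?_) (halfPlanePoisson_nonneg hz t)
      show 0 < ((t : ℂ) + ε * I).im
      simpa using hε
    · filter_upwards [hl] with p hp using tendsto_const_nhds.mul hp
  have l2 : Tendsto (fun ε : ℝ => ∫ t : ℝ, (halfPlanePoisson z t : ℂ) * F (t + ε * I)) (𝓝[>] 0)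
      (𝓝 (F z)) := by
    refine (tendsto_vertical hF hz).congr' ?_
    filter_upwards [hpos] with ε hε
    exact (integral_halfPlanePoisson_mul_translate hF hM hz hε).symm
  exact tendsto_nhds_unique l1 l2

lemma IsInner.integral_halfPlanePoisson_mul {φ : ℂ → ℂ} (h : IsInner φ) {z : ℂ} (hz : 0 < z.im) :
    ∫ t : ℝ, (halfPlanePoisson z t : ℂ) * boundaryValue φ t = φ z := by
  obtain ⟨M, hM⟩ := h.bounded
  exact integral_halfPlanePoisson_mul_boundaryValue h.holomorphic hM h.boundary_limit hz

/-- Inner functions are bounded by one. -/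
lemma IsInner.norm_le_one {φ : ℂ → ℂ} (h : IsInner φ) {z : ℂ} (hz : 0 < z.im) : ‖φ z‖ ≤ 1 := by
  rw [← h.integral_halfPlanePoisson_mul hz, ← integral_halfPlanePoisson hz]
  refine norm_integral_le_of_norm_le (integrable_halfPlanePoisson hz) ?_
  filter_upwards [h.boundary_norm] with t ht
  rw [norm_mul, ht, norm_real, Real.norm_of_nonneg (halfPlanePoisson_nonneg hz t), mul_one]

/-- Symmetry of the boundary function extends to the half-plane. -/
lemma IsInner.apply_neg_conj {φ : ℂ → ℂ} (h : IsInner φ) (hs : IsSymmetric φ) {z : ℂ}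
    (hz : 0 < z.im) : φ (-conj z) = conj (φ z) := by
  have hz' : 0 < (-conj z).im := by simpa using hz
  rw [← h.integral_halfPlanePoisson_mul hz, ← h.integral_halfPlanePoisson_mul hz', ← integral_conj,
    ← integral_neg_eq_self]
  refine integral_congr_ae ?_
  filter_upwards [hs] with t ht
  rw [ht, map_mul, conj_ofReal]
  congr 2
  simp only [halfPlanePoisson, neg_im, conj_im, neg_neg, neg_re, conj_re]
  ring

/-! ### Boundary behaviour of Poisson integrals of finite measures -/

lemma setOf_le_div_sq_add_sq {p δ t : ℝ} (hδ : 0 < δ) (ht : 0 < t) (ht1 : t < 1) :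
    {x : ℝ | t ≤ δ ^ 2 / ((x - p) ^ 2 + δ ^ 2)} = Metric.closedBall p (δ * √(t⁻¹ - 1)) := by
  ext x
  have h1 : 0 < (x - p) ^ 2 + δ ^ 2 := by positivity
  have h2 : 0 ≤ t⁻¹ - 1 := sub_nonneg.2 (one_le_inv_iff₀.2 ⟨ht, ht1.le⟩)
  rw [Set.mem_ofPred_eq, Metric.mem_closedBall, Real.dist_eq, le_div_iff₀ h1,
    ← abs_of_nonneg (mul_nonneg hδ.le (Real.sqrt_nonneg (t⁻¹ - 1))), ← sq_le_sq, mul_pow,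
    Real.sq_sqrt h2, ← mul_le_mul_iff_right₀ (inv_pos.2 ht), inv_mul_cancel_left₀ ht.ne']
  constructor <;> intro h <;> nlinarith

lemma continuous_div_sq_add_sq (p : ℝ) {δ : ℝ} (hδ : 0 < δ) (a : ℝ) :
    Continuous fun x : ℝ => a / ((x - p) ^ 2 + δ ^ 2) := by
  have : ∀ x : ℝ, (x - p) ^ 2 + δ ^ 2 ≠ 0 := fun x => by positivity
  fun_prop (disch := assumption)

lemma integrable_div_sq_add_sq (μ : Measure ℝ) [IsFiniteMeasure μ] (p : ℝ) {δ : ℝ} (hδ : 0 < δ)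
    (a : ℝ) : Integrable (fun x : ℝ => a / ((x - p) ^ 2 + δ ^ 2)) μ := by
  refine Integrable.of_bound (continuous_div_sq_add_sq p hδ a).aestronglyMeasurable (|a| / δ ^ 2)
    (Eventually.of_forall fun x => ?_)
  rw [norm_div, Real.norm_eq_abs, Real.norm_of_nonneg (by positivity)]
  gcongr
  nlinarith [sq_nonneg (x - p)]

/-- Layer-cake formula: the superlevel sets of the kernel, normalised to have maximum 1, are balls
about `p`. The Poisson integral is thus an average of the ratios that define the symmetric
derivative. -/
lemma integral_div_sq_add_sq_eq (μ : Measure ℝ) [IsFiniteMeasure μ] (p : ℝ) {δ : ℝ} (hδ : 0 < δ) :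
    ∫ x, δ / ((x - p) ^ 2 + δ ^ 2) ∂μ =
      ∫ t in Set.Ioo (0 : ℝ) 1, μ.real (Metric.closedBall p (δ * √(t⁻¹ - 1))) / δ := by
  have h1 : ∫ x, δ / ((x - p) ^ 2 + δ ^ 2) ∂μ =
      (∫ x, δ ^ 2 / ((x - p) ^ 2 + δ ^ 2) ∂μ) / δ := by
    rw [← integral_div]
    congr 1
    ext x
    field_simp
  have h2 : Set.EqOn (fun t => μ.real {x : ℝ | t ≤ δ ^ 2 / ((x - p) ^ 2 + δ ^ 2)})
      (fun t => μ.real (Metric.closedBall p (δ * √(t⁻¹ - 1)))) (Set.Ioo 0 1) := fun t ht => by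
    simp only [setOf_le_div_sq_add_sq (p := p) hδ ht.1 ht.2]
  rw [h1, integral_div, (integrable_div_sq_add_sq μ p hδ _).integral_eq_integral_meas_le
    (Eventually.of_forall fun x => by positivity), ← setIntegral_congr_fun measurableSet_Ioo h2,
    ← integral_Ioc_eq_integral_Ioo]
  congr 1
  refine (setIntegral_eq_of_subset_of_forall_sdiff_eq_zero measurableSet_Ioi
    Set.Ioc_subset_Ioi_self fun t ht => ?_)
  have ht1 : 1 < t := by
    by_contra h
    exact ht.2 ⟨ht.1, not_lt.1 h⟩
  have : {x : ℝ | t ≤ δ ^ 2 / ((x - p) ^ 2 + δ ^ 2)} = ∅ := by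
    ext x
    simp only [Set.mem_ofPred_eq, Set.mem_empty_iff_false, iff_false, not_le]
    refine lt_of_le_of_lt ?_ ht1
    rw [div_le_one (by positivity)]
    nlinarith [sq_nonneg (x - p)]
  rw [this, measureReal_empty]

/-- Small radii are controlled by the convergent ratio, large ones by the total mass. The uniform
bound is what dominated convergence needs in the layer-cake formula. -/
lemma exists_measureReal_closedBall_le (μ : Measure ℝ) [IsFiniteMeasure μ] {p d : ℝ}
    (h : Tendsto (fun r => μ.real (Metric.closedBall p r) / r) (𝓝[>] 0) (𝓝 d)) :
    ∃ C, ∀ r > 0, μ.real (Metric.closedBall p r) ≤ C * r := by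
  have h1 : ∀ᶠ r in 𝓝[>] (0 : ℝ), μ.real (Metric.closedBall p r) / r < d + 1 :=
    h.eventually (gt_mem_nhds (by linarith))
  obtain ⟨r₀, hr₀, h2⟩ := mem_nhdsGT_iff_exists_Ioo_subset.1 h1
  have hr₀ : 0 < r₀ := hr₀
  refine ⟨max (d + 1) (μ.real Set.univ / r₀), fun r hr => ?_⟩
  by_cases hlt : r < r₀
  · have := h2 ⟨hr, hlt⟩
    rw [Set.mem_ofPred_eq, div_lt_iff₀ hr] at this
    exact this.le.trans (by gcongr; exact le_max_left _ _)
  · calc μ.real (Metric.closedBall p r) ≤ μ.real Set.univ := measureReal_mono (Set.subset_univ _)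
      _ = μ.real Set.univ / r₀ * r₀ := by field_simp
      _ ≤ max (d + 1) (μ.real Set.univ / r₀) * r := by
        gcongr
        · exact le_max_right _ _
        · exact not_lt.1 hlt

/-- Poisson integrals of a finite measure converge wherever the symmetric derivative exists. -/
lemma tendsto_integral_div_sq_add_sq (μ : Measure ℝ) [IsFiniteMeasure μ] {p d : ℝ}
    (h : Tendsto (fun r => μ.real (Metric.closedBall p r) / r) (𝓝[>] 0) (𝓝 d)) :
    Tendsto (fun δ => ∫ x, δ / ((x - p) ^ 2 + δ ^ 2) ∂μ) (𝓝[>] 0)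
      (𝓝 (d * ∫ t in Set.Ioo (0 : ℝ) 1, √(t⁻¹ - 1))) := by
  obtain ⟨C, hC⟩ := exists_measureReal_closedBall_le μ h
  have hpos : ∀ᶠ ε : ℝ in 𝓝[>] 0, 0 < ε := self_mem_nhdsWithin
  have hs : ∀ t ∈ Set.Ioo (0 : ℝ) 1, 0 < √(t⁻¹ - 1) := fun t ht =>
    Real.sqrt_pos.2 (sub_pos.2 (one_lt_inv_iff₀.2 ht))
  have hC0 : 0 ≤ C := by simpa using measureReal_nonneg.trans (hC 1 one_pos)
  rw [← integral_const_mul]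
  have : Tendsto (fun δ => ∫ t in Set.Ioo (0 : ℝ) 1,
      μ.real (Metric.closedBall p (δ * √(t⁻¹ - 1))) / δ) (𝓝[>] 0)
      (𝓝 (∫ t in Set.Ioo (0 : ℝ) 1, d * √(t⁻¹ - 1))) := by
    -- The bound `√(t⁻¹ - 1) ≤ t^(-1/2)` is integrable on `(0, 1)`.
    refine tendsto_integral_filter_of_dominated_convergence (fun t => C * t ^ (-1 / 2 : ℝ)) ?_ ?_ ?_ ?_
    · filter_upwards [hpos] with δ hδ
      have hm : Monotone fun r => μ.real (Metric.closedBall p r) := fun a b hab =>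
        measureReal_mono (Metric.closedBall_subset_closedBall hab)
      have : Measurable fun t : ℝ => δ * √(t⁻¹ - 1) := by fun_prop
      exact ((hm.measurable.comp this).div_const δ).aestronglyMeasurable
    · filter_upwards [hpos] with δ hδ
      filter_upwards [ae_restrict_mem measurableSet_Ioo] with t ht
      rw [Real.norm_of_nonneg (by positivity), div_le_iff₀ hδ]
      refine (hC _ (mul_pos hδ (hs t ht))).trans ?_
      have : √(t⁻¹ - 1) ≤ t ^ (-1 / 2 : ℝ) := by
        calc √(t⁻¹ - 1) ≤ √(t⁻¹) := Real.sqrt_le_sqrt (by linarith)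
          _ = t ^ (-1 / 2 : ℝ) := by
            rw [Real.sqrt_eq_rpow, ← Real.rpow_neg_one, ← Real.rpow_mul ht.1.le]; norm_num
      calc C * (δ * √(t⁻¹ - 1)) = C * √(t⁻¹ - 1) * δ := by ring
        _ ≤ _ := by gcongr
    · refine Integrable.const_mul ?_ _
      have := (intervalIntegral.intervalIntegrable_rpow' (a := 0) (b := 1) (r := (-1 / 2 : ℝ)) (by norm_num))
      rw [intervalIntegrable_iff_integrableOn_Ioo_of_le zero_le_one] at this
      exact this
    · filter_upwards [ae_restrict_mem measurableSet_Ioo] with t ht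
      have hl : Tendsto (fun δ => δ * √(t⁻¹ - 1)) (𝓝[>] 0) (𝓝[>] 0) := by
        refine tendsto_nhdsWithin_iff.2 ⟨?_, ?_⟩
        · simpa using ((continuous_mul_const (√(t⁻¹ - 1))).tendsto 0).mono_left nhdsWithin_le_nhds
        · filter_upwards [hpos] with δ hδ using mul_pos hδ (hs t ht)
      refine ((h.comp hl).mul_const (√(t⁻¹ - 1))).congr' ?_
      filter_upwards [hpos] with δ hδ
      have := (hs t ht).ne'
      simp only [Function.comp_apply]
      generalize √(t⁻¹ - 1) = s at this ⊢
      field_simp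
  refine this.congr' ?_
  filter_upwards [hpos] with δ hδ using (integral_div_sq_add_sq_eq μ p hδ).symm

/-- Besicovitch differentiation; the factor 2 appears because a ball of radius `r` has length `2r`.
-/
lemma ae_tendsto_measureReal_closedBall_div (μ : Measure ℝ) [IsFiniteMeasure μ] :
    ∀ᵐ p : ℝ, Tendsto (fun r => μ.real (Metric.closedBall p r) / r) (𝓝[>] 0)
      (𝓝 (2 * (μ.rnDeriv volume p).toReal)) := by
  filter_upwards [Besicovitch.ae_tendsto_rnDeriv μ volume, μ.rnDeriv_lt_top volume] with p hp hlt
  have h1 := ((ENNReal.tendsto_toReal hlt.ne).comp hp).const_mul 2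
  refine h1.congr' ?_
  filter_upwards [self_mem_nhdsWithin] with r (hr : 0 < r)
  simp only [Function.comp_apply, Real.volume_closedBall, ENNReal.toReal_div]
  rw [ENNReal.toReal_ofReal (by positivity), Measure.real]
  field_simp

lemma ae_exists_tendsto_integral_div_sq_add_sq (μ : Measure ℝ) [IsFiniteMeasure μ] :
    ∀ᵐ p : ℝ, ∃ L, Tendsto (fun δ => ∫ x, δ / ((x - p) ^ 2 + δ ^ 2) ∂μ) (𝓝[>] 0) (𝓝 L) := by
  filter_upwards [ae_tendsto_measureReal_closedBall_div μ] with p hp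
  exact ⟨_, tendsto_integral_div_sq_add_sq μ hp⟩

/-- The Poisson integral of a singular measure vanishes at almost all boundary points. -/
lemma ae_tendsto_integral_div_sq_add_sq_zero (μ : Measure ℝ) [IsFiniteMeasure μ]
    (hμ : μ ⟂ₘ volume) :
    ∀ᵐ p : ℝ, Tendsto (fun δ => ∫ x, δ / ((x - p) ^ 2 + δ ^ 2) ∂μ) (𝓝[>] 0) (𝓝 0) := by
  filter_upwards [ae_tendsto_measureReal_closedBall_div μ, (Measure.rnDeriv_eq_zero μ volume).2 hμ]
    with p hp h0
  simpa [h0] using tendsto_integral_div_sq_add_sq μ hp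

/-- A finite measure whose Poisson integral vanishes at almost all boundary points is singular. -/
lemma mutuallySingular_of_ae_tendsto_zero (μ : Measure ℝ) [IsFiniteMeasure μ]
    (h : ∀ᵐ p : ℝ, Tendsto (fun δ => ∫ x, δ / ((x - p) ^ 2 + δ ^ 2) ∂μ) (𝓝[>] 0) (𝓝 0)) :
    μ ⟂ₘ volume := by
  rw [← Measure.rnDeriv_eq_zero]
  filter_upwards [ae_tendsto_measureReal_closedBall_div μ, μ.rnDeriv_lt_top volume, h]
    with p hp hlt h0
  have h1 : Tendsto (fun r => μ.real (Metric.closedBall p r) / r) (𝓝[>] 0) (𝓝 0) := by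
    have h2 := h0.const_mul 2
    rw [mul_zero] at h2
    refine squeeze_zero' ?_ ?_ h2
    · filter_upwards [self_mem_nhdsWithin] with r (hr : 0 < r)
      positivity
    · filter_upwards [self_mem_nhdsWithin] with r (hr : 0 < r)
      -- On the ball of radius `r` the kernel of width `r` is at least `1 / (2r)`, so the Poisson
      -- integral dominates the ratio `μ(B(p, r)) / r` up to a factor 2.
      have h3 : ∫ x, (Metric.closedBall p r).indicator (fun _ => (2 * r)⁻¹) x ∂μ ≤
          ∫ x, r / ((x - p) ^ 2 + r ^ 2) ∂μ := by
        refine integral_mono ((integrable_const _).indicator Metric.isClosed_closedBall.measurableSet)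
          (integrable_div_sq_add_sq μ p hr r) fun x => ?_
        by_cases hx : x ∈ Metric.closedBall p r
        swap
        · simp only [Set.indicator_of_notMem hx]
          positivity
        simp only [Set.indicator_of_mem hx]
        rw [Metric.mem_closedBall, Real.dist_eq] at hx
        have h4 : (x - p) ^ 2 ≤ r ^ 2 := sq_le_sq' (abs_le.1 hx).1 (abs_le.1 hx).2
        rw [inv_eq_one_div, div_le_div_iff₀ (by positivity) (by positivity)]
        nlinarith
      rw [integral_indicator_const _ Metric.isClosed_closedBall.measurableSet, smul_eq_mul] at h3
      calc μ.real (Metric.closedBall p r) / r = 2 * (μ.real (Metric.closedBall p r) * (2 * r)⁻¹) := by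
            field_simp
        _ ≤ _ := by gcongr
  have h5 := tendsto_nhds_unique hp h1
  have h6 : (μ.rnDeriv volume p).toReal = 0 := by linarith
  exact ((ENNReal.toReal_eq_zero_iff _).1 h6).resolve_right hlt.ne

lemma ae_comp_neg {P : ℝ → Prop} (h : ∀ᵐ p : ℝ, P p) : ∀ᵐ p : ℝ, P (-p) :=
  (Measure.measurePreserving_neg (volume : Measure ℝ)).quasiMeasurePreserving.ae h

/-! ### The Herglotz kernel on the line -/

/-- The kernel `Im ((1 + x z) / (x - z))` at `z = p + i δ`. -/
noncomputable def herglotzKernel (z : ℂ) (x : ℝ) : ℝ :=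
  z.im * (1 + x ^ 2) / ((x - z.re) ^ 2 + z.im ^ 2)

lemma herglotzKernel_nonneg {z : ℂ} (hz : 0 < z.im) (x : ℝ) : 0 ≤ herglotzKernel z x := by
  unfold herglotzKernel; positivity

lemma continuous_herglotzKernel {z : ℂ} (hz : 0 < z.im) : Continuous (herglotzKernel z) := by
  unfold herglotzKernel
  have : ∀ t : ℝ, (t - z.re) ^ 2 + z.im ^ 2 ≠ 0 := fun t => by positivity
  fun_prop (disch := assumption)

lemma herglotzKernel_le {z : ℂ} (hz : 0 < z.im) (x : ℝ) :
    herglotzKernel z x ≤ z.im * 2 + (1 + 2 * z.re ^ 2) / z.im := by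
  unfold herglotzKernel
  rw [div_le_iff₀ (by positivity)]
  have e : (z.im * 2 + (1 + 2 * z.re ^ 2) / z.im) * ((x - z.re) ^ 2 + z.im ^ 2) =
    2 * z.im * (x - z.re) ^ 2 + 2 * z.im ^ 3 + (1 + 2 * z.re ^ 2) / z.im * (x - z.re) ^ 2 +
      (1 + 2 * z.re ^ 2) * z.im := by field_simp; ring
  rw [e]
  have h1 : 0 ≤ (1 + 2 * z.re ^ 2) / z.im * (x - z.re) ^ 2 := by positivity
  have h2 : 0 ≤ z.im ^ 3 := by positivity
  nlinarith [mul_nonneg hz.le (sq_nonneg (x - 2 * z.re))]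

lemma integrable_herglotzKernel (μ : Measure ℝ) [IsFiniteMeasure μ] {z : ℂ} (hz : 0 < z.im) :
    Integrable (herglotzKernel z) μ := by
  refine Integrable.of_bound (continuous_herglotzKernel hz).aestronglyMeasurable
    (z.im * 2 + (1 + 2 * z.re ^ 2) / z.im) (Eventually.of_forall fun x => ?_)
  rw [Real.norm_of_nonneg (herglotzKernel_nonneg hz x)]
  exact herglotzKernel_le hz x

lemma abs_mul_div_sq_add_sq_le {u δ : ℝ} (p : ℝ) (hδ : 0 < δ) (hδ1 : δ ≤ 1) :
    |δ * (2 * p * u + u ^ 2) / (u ^ 2 + δ ^ 2)| ≤ |p| + 1 := by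
  rw [abs_div, abs_of_pos (by positivity : 0 < u ^ 2 + δ ^ 2), div_le_iff₀ (by positivity), abs_mul,
    abs_of_pos hδ]
  have h1 : |2 * p * u + u ^ 2| ≤ 2 * |p| * |u| + u ^ 2 := by
    refine (abs_add_le _ _).trans ?_
    rw [abs_mul, abs_mul, abs_two, abs_of_nonneg (sq_nonneg u)]
  have h2 : 2 * δ * |u| ≤ u ^ 2 + δ ^ 2 := by nlinarith [sq_nonneg (|u| - δ), sq_abs u]
  calc δ * |2 * p * u + u ^ 2| ≤ δ * (2 * |p| * |u| + u ^ 2) := by gcongr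
    _ = |p| * (2 * δ * |u|) + δ * u ^ 2 := by ring
    _ ≤ |p| * (u ^ 2 + δ ^ 2) + 1 * (u ^ 2 + δ ^ 2) := by
      gcongr
      nlinarith
    _ = _ := by ring

/-- The Herglotz kernel and the Poisson kernel have proportional boundary behaviour. -/
lemma tendsto_integral_herglotzKernel (μ : Measure ℝ) [IsFiniteMeasure μ] {p L : ℝ}
    (h : Tendsto (fun δ => ∫ x, δ / ((x - p) ^ 2 + δ ^ 2) ∂μ) (𝓝[>] 0) (𝓝 L)) :
    Tendsto (fun δ : ℝ => ∫ x, herglotzKernel (p + δ * Complex.I) x ∂μ) (𝓝[>] 0)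
      (𝓝 ((1 + p ^ 2) * L)) := by
  have hpos : ∀ᶠ ε : ℝ in 𝓝[>] 0, 0 < ε := self_mem_nhdsWithin
  have hle : ∀ᶠ ε : ℝ in 𝓝[>] 0, ε ≤ 1 :=
    (eventually_le_nhds zero_lt_one).filter_mono nhdsWithin_le_nhds
  have hcont : ∀ δ : ℝ, 0 < δ →
      Continuous fun x : ℝ => δ * (2 * p * (x - p) + (x - p) ^ 2) / ((x - p) ^ 2 + δ ^ 2) := by
    intro δ hδ
    have : ∀ x : ℝ, (x - p) ^ 2 + δ ^ 2 ≠ 0 := fun x => by positivity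
    fun_prop (disch := assumption)
  -- With `u = x - p` one has `1 + x² = (1 + p²) + (2pu + u²)`. The second summand vanishes at `u =
  -- 0`, so its contribution stays bounded and tends to 0 pointwise.
  have h1 : Tendsto (fun δ : ℝ => ∫ x, δ * (2 * p * (x - p) + (x - p) ^ 2) /
      ((x - p) ^ 2 + δ ^ 2) ∂μ) (𝓝[>] 0) (𝓝 (∫ _, (0 : ℝ) ∂μ)) := by
    refine tendsto_integral_filter_of_dominated_convergence (fun _ => |p| + 1) ?_ ?_
      (integrable_const _) ?_
    · filter_upwards [hpos] with δ hδ using (hcont δ hδ).aestronglyMeasurable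
    · filter_upwards [hpos, hle] with δ hδ h1
      exact Eventually.of_forall fun x => abs_mul_div_sq_add_sq_le p hδ h1
    · refine Eventually.of_forall fun x => ?_
      by_cases hx : x - p = 0
      · simp [hx]
      · have : ContinuousAt (fun δ : ℝ => δ * (2 * p * (x - p) + (x - p) ^ 2) /
            ((x - p) ^ 2 + δ ^ 2)) 0 := by
          refine ContinuousAt.div (by fun_prop) (by fun_prop) ?_
          simpa using hx
        simpa using this.tendsto.mono_left nhdsWithin_le_nhds
  have h2 := (h.const_mul (1 + p ^ 2)).add h1
  rw [integral_zero, add_zero] at h2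
  refine h2.congr' ?_
  filter_upwards [hpos, hle] with δ hδ hδ1
  rw [← integral_const_mul, ← integral_add ((integrable_div_sq_add_sq μ p hδ δ).const_mul _)]
  · congr 1
    ext x
    have : (x - p) ^ 2 + δ ^ 2 ≠ 0 := by positivity
    simp only [herglotzKernel, Complex.add_re, Complex.add_im, Complex.mul_re, Complex.mul_im,
      Complex.ofReal_re, Complex.ofReal_im, Complex.I_re, Complex.I_im, mul_zero, mul_one, zero_add,
      add_zero, sub_zero]
    field_simp
    ring
  · exact Integrable.of_bound (hcont δ hδ).aestronglyMeasurable (|p| + 1)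
      (Eventually.of_forall fun x => abs_mul_div_sq_add_sq_le p hδ hδ1)

/-! ### Herglotz representation on the disc and the half-plane -/

lemma sub_ne_zero_of_mem_sphere_of_mem_ball {ζ w : ℂ} (hζ : ζ ∈ Metric.sphere (0 : ℂ) 1)
    (hw : w ∈ Metric.ball (0 : ℂ) 1) : ζ - w ≠ 0 := by
  rintro h
  rw [sub_eq_zero] at h
  rw [← h, mem_ball_zero_iff, mem_sphere_zero_iff_norm.1 hζ] at hw
  exact lt_irrefl _ hw

lemma continuous_re_herglotz {w : ℂ} (hw : w ∈ Metric.ball (0 : ℂ) 1) :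
    Continuous fun ζ : Metric.sphere (0 : ℂ) 1 => (((ζ : ℂ) + w) / (ζ - w)).re := by
  refine continuous_re.comp (Continuous.div (by fun_prop) (by fun_prop) fun ζ => ?_)
  exact sub_ne_zero_of_mem_sphere_of_mem_ball ζ.2 hw

/-- The Herglotz formula for a function which is continuous on the closed unit disc. -/
lemma exists_measure_sphere_of_diffContOnCl {G : ℂ → ℂ} (hG : DiffContOnCl ℂ G (Metric.ball 0 1))
    (him : ∀ ζ ∈ Metric.sphere (0 : ℂ) 1, 0 ≤ (G ζ).im) :
    ∃ ρ : FiniteMeasure (Metric.sphere (0 : ℂ) 1), ∀ w ∈ Metric.ball (0 : ℂ) 1,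
      (G w).im = ∫ ζ, (((ζ : ℂ) + w) / (ζ - w)).re ∂(ρ : Measure (Metric.sphere (0 : ℂ) 1)) := by
  have hcl : closure (Metric.ball (0 : ℂ) 1) = Metric.closedBall 0 1 := closure_ball _ one_ne_zero
  have hcirc : Continuous fun θ : ℝ => G (circleMap 0 1 θ) := by
    refine hG.continuousOn.comp_continuous (continuous_circleMap 0 1) fun θ => ?_
    rw [hcl]
    exact Metric.sphere_subset_closedBall (circleMap_mem_sphere 0 zero_le_one θ)
  let e : ℝ → Metric.sphere (0 : ℂ) 1 := fun θ => ⟨circleMap 0 1 θ, circleMap_mem_sphere 0 zero_le_one θ⟩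
  have he : Continuous e := (continuous_circleMap 0 1).subtype_mk _
  have hd : Continuous fun θ : ℝ => (2 * Real.pi)⁻¹ * (G (circleMap 0 1 θ)).im :=
    continuous_const.mul (continuous_im.comp hcirc)
  have hd0 : ∀ θ : ℝ, 0 ≤ (2 * Real.pi)⁻¹ * (G (circleMap 0 1 θ)).im := fun θ =>
    mul_nonneg (by positivity) (him _ (circleMap_mem_sphere 0 zero_le_one θ))
  -- The representing measure is the boundary density of `Im G`; the factor `(2π)⁻¹` is that of the
  -- circle average.
  let m : Measure ℝ := (volume.restrict (Set.Ioc 0 (2 * Real.pi))).withDensity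
    fun θ => ENNReal.ofReal ((2 * Real.pi)⁻¹ * (G (circleMap 0 1 θ)).im)
  have hm : IsFiniteMeasure m :=
    isFiniteMeasure_withDensity_ofReal (hd.integrableOn_Ioc (μ := volume)).2
  refine ⟨⟨m.map e, inferInstance⟩, fun w hw => ?_⟩
  have h1 := hG.circleAverage_re_herglotzRieszKernel_smul' hw
  simp only [sub_zero] at h1
  have hker : Continuous fun θ : ℝ => ((circleMap 0 1 θ + w) / (circleMap 0 1 θ - w)).re :=
    (continuous_re_herglotz hw).comp he
  show (G w).im = ∫ ζ, (((ζ : ℂ) + w) / (ζ - w)).re ∂(m.map e)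
  rw [integral_map he.aemeasurable (continuous_re_herglotz hw).aestronglyMeasurable,
    integral_withDensity_eq_integral_toReal_smul hd.measurable.ennreal_ofReal (by simp), ← h1, Real.circleAverage,
    intervalIntegral.integral_of_le (by positivity), ← integral_smul]
  have h2 : Integrable (fun θ : ℝ => (2 * Real.pi)⁻¹ •
      (((circleMap 0 1 θ + w) / (circleMap 0 1 θ - w)).re • G (circleMap 0 1 θ)))
      (volume.restrict (Set.Ioc 0 (2 * Real.pi))) :=
    ((continuous_const (y := (2 * Real.pi)⁻¹)).smul (hker.smul hcirc)).integrableOn_Ioc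
  rw [← imCLM_apply, ← imCLM.integral_comp_comm h2]
  refine integral_congr_ae (Eventually.of_forall fun θ => ?_)
  simp only [e, imCLM_apply, ENNReal.toReal_ofReal (hd0 θ), smul_im, smul_eq_mul]
  ring

/-- The Herglotz representation theorem for the unit disc. -/
lemma exists_measure_sphere {g : ℂ → ℂ} (hg : DifferentiableOn ℂ g (Metric.ball 0 1))
    (him : ∀ w ∈ Metric.ball (0 : ℂ) 1, 0 ≤ (g w).im) :
    ∃ ρ : FiniteMeasure (Metric.sphere (0 : ℂ) 1), ∀ w ∈ Metric.ball (0 : ℂ) 1,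
      (g w).im = ∫ ζ, (((ζ : ℂ) + w) / (ζ - w)).re ∂(ρ : Measure (Metric.sphere (0 : ℂ) 1)) := by
  let r : ℕ → ℝ := fun n => 1 - 1 / ((n : ℝ) + 1)
  have hr0 : ∀ n, 0 ≤ r n := fun n => sub_nonneg.2 (by
    rw [div_le_one (by positivity)]; linarith [Nat.cast_nonneg (α := ℝ) n])
  have hr1 : ∀ n, r n < 1 := fun n => sub_lt_self _ (by positivity)
  have hrt : Tendsto r atTop (𝓝 1) := by
    simpa [r] using (tendsto_one_div_add_atTop_nhds_zero_nat (𝕜 := ℝ)).const_sub 1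
  have hmap : ∀ n, ∀ w ∈ Metric.closedBall (0 : ℂ) 1, (r n : ℂ) * w ∈ Metric.ball (0 : ℂ) 1 := by
    intro n w hw
    rw [mem_ball_zero_iff, norm_mul, norm_real, Real.norm_of_nonneg (hr0 n)]
    rw [mem_closedBall_zero_iff] at hw
    exact (mul_le_of_le_one_right (hr0 n) hw).trans_lt (hr1 n)
  have hex : ∀ n, ∃ ρ : FiniteMeasure (Metric.sphere (0 : ℂ) 1), ∀ w ∈ Metric.ball (0 : ℂ) 1,
      (g (r n * w)).im = ∫ ζ, (((ζ : ℂ) + w) / (ζ - w)).re ∂(ρ : Measure (Metric.sphere (0 : ℂ) 1)) := by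
    intro n
    refine exists_measure_sphere_of_diffContOnCl (G := fun w => g (r n * w)) ?_ fun ζ hζ =>
      him _ (hmap n ζ (Metric.sphere_subset_closedBall hζ))
    refine DifferentiableOn.diffContOnCl ?_
    rw [closure_ball _ one_ne_zero]
    exact hg.comp (by fun_prop) (hmap n)
  choose ρ hρ using hex
  -- At `w = 0` the kernel is 1, so every dilate has the same mass `Im g(0)`; this confines the
  -- measures to a weakly compact set.
  have hmass : ∀ n, (ρ n).mass ≤ (g 0).im.toNNReal := by
    intro n
    have h1 := hρ n 0 (Metric.mem_ball_self one_pos)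
    have h2 : ∫ ζ : Metric.sphere (0 : ℂ) 1, (((ζ : ℂ) + 0) / (ζ - 0)).re ∂(ρ n : Measure _) =
        (ρ n).mass := by
      have : ∀ ζ : Metric.sphere (0 : ℂ) 1, (((ζ : ℂ) + 0) / (ζ - 0)).re = 1 := fun ζ => by
        have := sub_ne_zero_of_mem_sphere_of_mem_ball ζ.2 (Metric.mem_ball_self one_pos)
        rw [add_zero, sub_zero] at *
        rw [div_self this, one_re]
      simp only [this, integral_const, smul_eq_mul, mul_one]
      rfl
    rw [h2, mul_zero] at h1
    rw [h1, Real.toNNReal_coe]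
  -- A limit along a free ultrafilter takes the place of a convergent subsequence.
  obtain ⟨ρ₀, -, hρ₀⟩ := isCompact_iff_ultrafilter_le_nhds'.1
    (isCompact_setOfPred_finiteMeasure_le_of_compactSpace (Metric.sphere (0 : ℂ) 1)
      (g 0).im.toNNReal) ((hyperfilter ℕ).map ρ) (Filter.mem_map.2 (Eventually.of_forall hmass))
  refine ⟨ρ₀, fun w hw => ?_⟩
  have h1 : Tendsto ρ (hyperfilter ℕ) (𝓝 ρ₀) := hρ₀
  have h2 := FiniteMeasure.tendsto_iff_forall_integral_tendsto.1 h1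
    (BoundedContinuousFunction.mkOfCompact ⟨_, continuous_re_herglotz hw⟩)
  have h3 : Tendsto (fun n => (g (r n * w)).im) (hyperfilter ℕ) (𝓝 (g w).im) := by
    have hc : ContinuousAt g w := (hg.differentiableAt (Metric.isOpen_ball.mem_nhds hw)).continuousAt
    have hl : Tendsto (fun n => (r n : ℂ) * w) atTop (𝓝 w) := by
      simpa using ((continuous_ofReal.tendsto 1).comp hrt).mul_const w
    refine ((continuous_im.tendsto _).comp (hc.tendsto.comp hl)).mono_left ?_
    rw [← Nat.cofinite_eq_atTop]
    exact hyperfilter_le_cofinite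
  refine tendsto_nhds_unique h3 (h2.congr fun n => ?_)
  rw [hρ n w hw]
  rfl

/-- The inverse Cayley transform on the unit circle. -/
noncomputable def circleToLine (ζ : ℂ) : ℝ := (I * (1 + ζ) / (1 - ζ)).re

/-- Since `ζ̄ = ζ⁻¹` on the circle, the Cayley image equals its own conjugate. -/
lemma ofReal_circleToLine {ζ : ℂ} (hζ : ‖ζ‖ = 1) (h1 : ζ ≠ 1) :
    (circleToLine ζ : ℂ) = I * (1 + ζ) / (1 - ζ) := by
  have h2 : ζ * conj ζ = 1 := by rw [mul_conj, normSq_eq_norm_sq, hζ]; simp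
  have h3 : 1 - ζ ≠ 0 := sub_ne_zero.2 h1.symm
  have h4 : 1 - conj ζ ≠ 0 := by
    intro h
    apply h3
    have := congrArg conj h
    simpa using this
  refine (conj_eq_iff_re (z := I * (1 + ζ) / (1 - ζ))).1 ?_
  simp only [map_div₀, map_mul, conj_I, map_add, map_one, map_sub]
  rw [div_eq_div_iff h4 h3]
  linear_combination (2 * I) * h2

lemma cayley_mem_ball {z : ℂ} (hz : 0 < z.im) : (z - I) / (z + I) ∈ Metric.ball (0 : ℂ) 1 := by
  have h0 : 0 < ‖z + I‖ := norm_pos_iff.2 fun h => by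
    have := congrArg im h; simp at this; linarith
  rw [mem_ball_zero_iff, norm_div, div_lt_one h0, ← sq_lt_sq₀ (norm_nonneg _) (norm_nonneg _),
    ← normSq_eq_norm_sq, ← normSq_eq_norm_sq, normSq_apply, normSq_apply]
  simp
  nlinarith

lemma add_I_ne_zero {z : ℂ} (hz : 0 < z.im) : z + I ≠ 0 := fun h => by
  have := congrArg im h; simp at this; linarith

/-- The Herglotz kernel of the disc in half-plane coordinates. -/
lemma re_herglotz_eq_herglotzKernel {z ζ : ℂ} (hz : 0 < z.im) (hζ : ‖ζ‖ = 1) (h1 : ζ ≠ 1) :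
    ((ζ + (z - I) / (z + I)) / (ζ - (z - I) / (z + I))).re = herglotzKernel z (circleToLine ζ) := by
  set x := circleToLine ζ with hx
  have hxe : (x : ℂ) = I * (1 + ζ) / (1 - ζ) := ofReal_circleToLine hζ h1
  have h3 : 1 - ζ ≠ 0 := sub_ne_zero.2 h1.symm
  have hxI : (x : ℂ) + I ≠ 0 := fun h => by have := congrArg im h; simp at this
  have hζx : ζ = (x - I) / (x + I) := by
    rw [eq_div_iff hxI, hxe]
    field_simp
    ring
  have hzI := add_I_ne_zero hz
  have hxz : (x : ℂ) - z ≠ 0 := fun h => by have := congrArg im h; simp at this; linarith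
  have hq : (ζ + (z - I) / (z + I)) / (ζ - (z - I) / (z + I)) = -I * ((1 + x * z) / (x - z)) := by
    have h4 : ζ - (z - I) / (z + I) = 2 * I * (x - z) / ((x + I) * (z + I)) := by
      rw [hζx]; field_simp; ring
    have h5 : ζ + (z - I) / (z + I) = 2 * (1 + x * z) / ((x + I) * (z + I)) := by
      rw [hζx]; field_simp; linear_combination (-2) * I_sq
    rw [h4, h5]
    field_simp
    linear_combination (1 + x * z) * I_sq
  rw [hq]
  have hden : normSq ((x : ℂ) - z) = (x - z.re) ^ 2 + z.im ^ 2 := by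
    rw [normSq_apply]; simp; ring
  have hden0 : (x - z.re) ^ 2 + z.im ^ 2 ≠ 0 := by positivity
  rw [herglotzKernel, neg_mul, neg_re, I_mul_re, neg_neg, div_im, hden]
  simp
  field_simp
  ring

/-- The Herglotz representation theorem for the upper half-plane. -/
theorem exists_herglotz_representation {f : ℂ → ℂ}
    (hf : DifferentiableOn ℂ f UpperHalfPlane.upperHalfPlaneSet)
    (him : ∀ z ∈ UpperHalfPlane.upperHalfPlaneSet, 0 ≤ (f z).im) :
    ∃ (c : ℝ) (μ : Measure ℝ), 0 ≤ c ∧ IsFiniteMeasure μ ∧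
      ∀ z ∈ UpperHalfPlane.upperHalfPlaneSet, (f z).im = c * z.im + ∫ x, herglotzKernel z x ∂μ := by
  have hC : ∀ w ∈ Metric.ball (0 : ℂ) 1, 0 < (I * (1 + w) / (1 - w)).im := by
    intro w hw
    have h1 : (1 : ℂ) - w ≠ 0 := sub_ne_zero_of_mem_sphere_of_mem_ball (by simp) hw
    rw [mem_ball_zero_iff] at hw
    have h2 : normSq w < 1 := by rw [normSq_eq_norm_sq]; nlinarith [norm_nonneg w]
    rw [normSq_apply] at h2
    rw [div_im, ← sub_div]
    refine div_pos ?_ (normSq_pos.2 h1)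
    simp
    nlinarith
  obtain ⟨ρ, hρ⟩ := exists_measure_sphere (g := fun w => f (I * (1 + w) / (1 - w)))
    (hf.comp (DifferentiableOn.div (by fun_prop) (by fun_prop) fun w hw =>
      sub_ne_zero_of_mem_sphere_of_mem_ball (by simp) hw) hC) (fun w hw => him _ (hC w hw))
  let ρ' : Measure (Metric.sphere (0 : ℂ) 1) := ρ
  let o : Metric.sphere (0 : ℂ) 1 := ⟨1, by simp⟩
  have hmeas : Measurable fun ζ : Metric.sphere (0 : ℂ) 1 => circleToLine ζ := by
    unfold circleToLine; fun_prop
  -- The point `ζ = 1` corresponds to infinity: its mass becomes the linear coefficient `c`, and the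
  -- rest of the measure moves to the line.
  refine ⟨ρ'.real {o}, (ρ'.restrict {o}ᶜ).map fun ζ : Metric.sphere (0 : ℂ) 1 => circleToLine ζ, measureReal_nonneg,
    inferInstance, fun z hz => ?_⟩
  have hz : 0 < z.im := hz
  have hw := cayley_mem_ball hz
  have hzI := add_I_ne_zero hz
  have h1 := hρ _ hw
  have hinv : I * (1 + (z - I) / (z + I)) / (1 - (z - I) / (z + I)) = z := by
    have h2 : 1 - (z - I) / (z + I) = 2 * I / (z + I) := by field_simp; ring
    have h3 : 1 + (z - I) / (z + I) = 2 * z / (z + I) := by field_simp; ring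
    rw [h2, h3]; field_simp
  simp only [hinv] at h1
  have hint : Integrable (fun ζ : Metric.sphere (0 : ℂ) 1 =>
      (((ζ : ℂ) + (z - I) / (z + I)) / (ζ - (z - I) / (z + I))).re) ρ' :=
    (BoundedContinuousFunction.mkOfCompact ⟨_, continuous_re_herglotz hw⟩).integrable ρ'
  rw [h1, ← integral_add_compl (measurableSet_singleton o) hint, integral_singleton,
    integral_map hmeas.aemeasurable (continuous_herglotzKernel hz).aestronglyMeasurable]
  congr 1
  · rw [smul_eq_mul]
    congr 1
    have h2 : (1 : ℂ) - (z - I) / (z + I) = 2 * I / (z + I) := by field_simp; ring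
    have h3 : (1 : ℂ) + (z - I) / (z + I) = 2 * z / (z + I) := by field_simp; ring
    show ((1 + (z - I) / (z + I)) / (1 - (z - I) / (z + I))).re = z.im
    have h4 : 2 * z / (z + I) / (2 * I / (z + I)) = -I * z := by
      field_simp; linear_combination z * I_sq
    rw [h2, h3, h4]; simp
  · refine setIntegral_congr_fun (measurableSet_singleton o).compl fun ζ hζ => ?_
    refine re_herglotz_eq_herglotzKernel hz (mem_sphere_zero_iff_norm.1 ζ.2) fun h => hζ ?_
    exact Subtype.ext h

/-! ### Fatou's theorem -/

/-- By the Herglotz formula the imaginary part is `c ε` plus a Herglotz integral, which converges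
wherever the measure has a symmetric derivative. -/
lemma ae_exists_tendsto_im {f : ℂ → ℂ}
    (hf : DifferentiableOn ℂ f UpperHalfPlane.upperHalfPlaneSet)
    (him : ∀ z ∈ UpperHalfPlane.upperHalfPlaneSet, 0 ≤ (f z).im) :
    ∀ᵐ p : ℝ, ∃ L : ℝ, Tendsto (fun ε : ℝ => (f (p + ε * I)).im) (𝓝[>] 0) (𝓝 L) := by
  obtain ⟨c, μ, -, hμ, h⟩ := exists_herglotz_representation hf him
  filter_upwards [ae_exists_tendsto_integral_div_sq_add_sq μ] with p ⟨L, hL⟩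
  have h0 : Tendsto (fun ε : ℝ => c * ε) (𝓝[>] 0) (𝓝 (c * 0)) :=
    ((continuous_const_mul c).tendsto 0).mono_left nhdsWithin_le_nhds
  refine ⟨_, (h0.add (tendsto_integral_herglotzKernel μ hL)).congr' ?_⟩
  filter_upwards [self_mem_nhdsWithin] with ε (hε : 0 < ε)
  rw [h _ (show 0 < ((p : ℂ) + ε * I).im by simpa using hε)]
  simp

/-- Fatou's theorem for the upper half-plane. -/
theorem ae_hasBoundaryLimit_of_bounded {F : ℂ → ℂ} {M : ℝ}
    (hF : DifferentiableOn ℂ F UpperHalfPlane.upperHalfPlaneSet)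
    (hM : ∀ ζ ∈ UpperHalfPlane.upperHalfPlaneSet, ‖F ζ‖ ≤ M) :
    ∀ᵐ p : ℝ, HasBoundaryLimit F p (boundaryValue F p) := by
  -- The two auxiliary functions have the nonnegative imaginary parts `M + Re F` and `M + Im F`.
  have h1 := ae_exists_tendsto_im (f := fun z => I * (M + F z)) (by fun_prop) fun z hz => by
    have := (neg_le_abs _).trans ((abs_re_le_norm (F z)).trans (hM z hz))
    simp; linarith
  have h2 := ae_exists_tendsto_im (f := fun z => I * M + F z) (by fun_prop) fun z hz => by
    have := (neg_le_abs _).trans ((abs_im_le_norm (F z)).trans (hM z hz))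
    simp; linarith
  filter_upwards [h1, h2] with p ⟨a, ha⟩ ⟨b, hb⟩
  have h3 : HasBoundaryLimit F p (((a - M : ℝ) : ℂ) + ((b - M : ℝ) : ℂ) * I) := by
    have h4 := ((continuous_ofReal.tendsto _).comp (ha.sub_const M)).add
      (((continuous_ofReal.tendsto _).comp (hb.sub_const M)).mul_const I)
    refine h4.congr fun ε => ?_
    apply Complex.ext <;> simp
  rwa [h3.boundaryValue_eq]

/-! ### The symmetric Herglotz integral -/

/-- The kernel `z (1 + x²) / (x² - z²)` of the symmetric Herglotz representation. -/
noncomputable def symmetricKernel (z : ℂ) (x : ℝ) : ℂ := z * (1 + x ^ 2) / (x ^ 2 - z ^ 2)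

/-- The function `c z + ∫ z (1 + x²) / (x² - z²) dm(x)` on the upper half-plane. -/
noncomputable def symmetricHerglotz (c : ℝ) (m : Measure ℝ) (z : ℂ) : ℂ :=
  c * z + ∫ x, symmetricKernel z x ∂m

lemma ofReal_sub_ne_zero {z : ℂ} (hz : 0 < z.im) (x : ℝ) : (x : ℂ) - z ≠ 0 := fun h => by
  have := congrArg im h; simp at this; linarith

lemma sq_sub_sq_ne_zero {z : ℂ} (hz : 0 < z.im) (x : ℝ) : (x : ℂ) ^ 2 - z ^ 2 ≠ 0 := by
  have h1 := ofReal_sub_ne_zero hz x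
  have h2 := ofReal_sub_ne_zero hz (-x)
  have : (x : ℂ) ^ 2 - z ^ 2 = -((x - z) * ((-x : ℝ) - z)) := by push_cast; ring
  rw [this]
  exact neg_ne_zero.2 (mul_ne_zero h1 h2)

lemma symmetricKernel_eq {z : ℂ} (hz : 0 < z.im) (x : ℝ) :
    symmetricKernel z x = (1 + x ^ 2) / 2 * (((x : ℂ) - z)⁻¹ + (((-x : ℝ) : ℂ) - z)⁻¹) := by
  have h1 := ofReal_sub_ne_zero hz x
  have h2 := ofReal_sub_ne_zero hz (-x)
  have h3 := sq_sub_sq_ne_zero hz x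
  rw [symmetricKernel]
  push_cast at h2 ⊢
  field_simp
  ring

/-- Here the growing weight `1 + x²` is gone and only resolvents, bounded in `x`, remain. This gives
integrability against finite measures, and holomorphy through the resolvent transforms of `m` and
its reflection. -/
lemma symmetricKernel_eq' {z : ℂ} (hz : 0 < z.im) (x : ℝ) :
    symmetricKernel z x = z + (1 + z ^ 2) / 2 * (((x : ℂ) - z)⁻¹ + (((-x : ℝ) : ℂ) - z)⁻¹) := by
  have h1 := ofReal_sub_ne_zero hz x
  have h2 := ofReal_sub_ne_zero hz (-x)
  have h3 := sq_sub_sq_ne_zero hz x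
  rw [symmetricKernel]
  push_cast at h2 ⊢
  field_simp
  ring

lemma normSq_ofReal_sub (z : ℂ) (x : ℝ) :
    normSq ((x : ℂ) - z) = (x - z.re) ^ 2 + z.im ^ 2 := by
  rw [normSq_apply]; simp; ring

lemma symmetricKernel_re {z : ℂ} (hz : 0 < z.im) (x : ℝ) :
    (symmetricKernel z x).re = (1 + x ^ 2) / 2 *
      ((x - z.re) / ((x - z.re) ^ 2 + z.im ^ 2) - (x + z.re) / ((x + z.re) ^ 2 + z.im ^ 2)) := by
  have : ((1 : ℂ) + x ^ 2) / 2 = (((1 + x ^ 2) / 2 : ℝ) : ℂ) := by push_cast; ring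
  rw [symmetricKernel_eq hz, this, re_ofReal_mul, add_re, inv_re, inv_re, normSq_ofReal_sub,
    normSq_ofReal_sub]
  simp only [sub_re, ofReal_re]
  rw [show (-x - z.re) ^ 2 = (x + z.re) ^ 2 by ring]
  ring

lemma symmetricKernel_im {z : ℂ} (hz : 0 < z.im) (x : ℝ) :
    (symmetricKernel z x).im = (1 + x ^ 2) / 2 *
      (z.im / ((x - z.re) ^ 2 + z.im ^ 2) + z.im / ((x + z.re) ^ 2 + z.im ^ 2)) := by
  have : ((1 : ℂ) + x ^ 2) / 2 = (((1 + x ^ 2) / 2 : ℝ) : ℂ) := by push_cast; ring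
  rw [symmetricKernel_eq hz, this, im_ofReal_mul, add_im, inv_im, inv_im, normSq_ofReal_sub,
    normSq_ofReal_sub]
  simp only [sub_im, ofReal_im]
  rw [show (-x - z.re) ^ 2 = (x + z.re) ^ 2 by ring]
  ring

lemma symmetricKernel_im_eq_herglotzKernel {z : ℂ} (hz : 0 < z.im) (x : ℝ) :
    (symmetricKernel z x).im = (herglotzKernel z x + herglotzKernel z (-x)) / 2 := by
  rw [symmetricKernel_im hz, herglotzKernel, herglotzKernel,
    show (-x - z.re) ^ 2 = (x + z.re) ^ 2 by ring]
  ring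

lemma symmetricKernel_im_nonneg {z : ℂ} (hz : 0 < z.im) (x : ℝ) : 0 ≤ (symmetricKernel z x).im := by
  rw [symmetricKernel_im hz]; positivity

lemma continuous_symmetricKernel {z : ℂ} (hz : 0 < z.im) : Continuous (symmetricKernel z) := by
  unfold symmetricKernel
  exact Continuous.div (by fun_prop) (by fun_prop) (sq_sub_sq_ne_zero hz)

lemma integrable_inv_ofReal_sub (m : Measure ℝ) [IsFiniteMeasure m] {z : ℂ} (hz : 0 < z.im) :
    Integrable (fun x : ℝ => ((x : ℂ) - z)⁻¹) m := by
  refine Integrable.of_bound (Continuous.inv₀ (by fun_prop) (ofReal_sub_ne_zero hz)).aestronglyMeasurable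
    z.im⁻¹ (Eventually.of_forall fun x => ?_)
  rw [norm_inv]
  refine inv_anti₀ hz ?_
  simpa [abs_of_pos hz] using abs_im_le_norm ((x : ℂ) - z)

lemma integrable_inv_ofReal_neg_sub (m : Measure ℝ) [IsFiniteMeasure m] {z : ℂ} (hz : 0 < z.im) :
    Integrable (fun x : ℝ => (((-x : ℝ) : ℂ) - z)⁻¹) m :=
  (integrable_map_measure (integrable_inv_ofReal_sub (m.map Neg.neg) hz).1
    measurable_neg.aemeasurable).1 (integrable_inv_ofReal_sub (m.map Neg.neg) hz)

lemma integrable_symmetricKernel (m : Measure ℝ) [IsFiniteMeasure m] {z : ℂ} (hz : 0 < z.im) :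
    Integrable (symmetricKernel z) m := by
  rw [funext (symmetricKernel_eq' hz)]
  exact (integrable_const _).add
    (((integrable_inv_ofReal_sub m hz).add (integrable_inv_ofReal_neg_sub m hz)).const_mul _)

lemma differentiableOn_resolventTransform (m : Measure ℝ) [IsFiniteMeasure m] :
    DifferentiableOn ℂ (resolventTransform m) UpperHalfPlane.upperHalfPlaneSet := by
  intro z hz
  refine (hasDerivAt_resolventTransform z ?_).differentiableAt.differentiableWithinAt
  rintro ⟨x, -, rfl⟩
  have : 0 < ((x : ℂ)).im := hz
  simp at this

lemma resolventTransform_eq (m : Measure ℝ) (z : ℂ) :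
    resolventTransform m z = ∫ x : ℝ, ((x : ℂ) - z)⁻¹ ∂m := by
  simp [resolventTransform_apply, resolvent, Ring.inverse_eq_inv']

lemma differentiableOn_symmetricHerglotz (c : ℝ) (m : Measure ℝ) [IsFiniteMeasure m] :
    DifferentiableOn ℂ (symmetricHerglotz c m) UpperHalfPlane.upperHalfPlaneSet := by
  have h : Set.EqOn (symmetricHerglotz c m) (fun z => c * z + (m.real Set.univ * z + (1 + z ^ 2) / 2 *
      (resolventTransform m z + resolventTransform (m.map Neg.neg) z)))
      UpperHalfPlane.upperHalfPlaneSet := by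
    intro z hz
    have hz : 0 < z.im := hz
    have hi : Integrable (fun a : ℝ => (1 + z ^ 2) / 2 * (((a : ℂ) - z)⁻¹ + (((-a : ℝ) : ℂ) - z)⁻¹)) m :=
      ((integrable_inv_ofReal_sub m hz).add (integrable_inv_ofReal_neg_sub m hz)).const_mul _
    dsimp only
    rw [symmetricHerglotz, resolventTransform_eq, resolventTransform_eq, integral_map
      measurable_neg.aemeasurable (integrable_inv_ofReal_sub (m.map Neg.neg) hz).1,
      ← integral_add (integrable_inv_ofReal_sub m hz) (integrable_inv_ofReal_neg_sub m hz),
      integral_congr_ae (Eventually.of_forall (symmetricKernel_eq' hz)), integral_add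
      (integrable_const _) hi, integral_const, integral_const_mul]
    simp
  refine DifferentiableOn.congr ?_ h
  have h1 := differentiableOn_resolventTransform m
  have h2 := differentiableOn_resolventTransform (m.map Neg.neg)
  fun_prop

lemma symmetricHerglotz_im (c : ℝ) (m : Measure ℝ) [IsFiniteMeasure m] {z : ℂ} (hz : 0 < z.im) :
    (symmetricHerglotz c m z).im = c * z.im + ∫ x, (symmetricKernel z x).im ∂m := by
  rw [symmetricHerglotz, add_im, im_ofReal_mul, ← imCLM_apply (∫ x, symmetricKernel z x ∂m),
    ← imCLM.integral_comp_comm (integrable_symmetricKernel m hz)]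
  rfl

lemma symmetricHerglotz_re (c : ℝ) (m : Measure ℝ) [IsFiniteMeasure m] {z : ℂ} (hz : 0 < z.im) :
    (symmetricHerglotz c m z).re = c * z.re + ∫ x, (symmetricKernel z x).re ∂m := by
  rw [symmetricHerglotz, add_re, re_ofReal_mul, ← reCLM_apply (∫ x, symmetricKernel z x ∂m),
    ← reCLM.integral_comp_comm (integrable_symmetricKernel m hz)]
  rfl

lemma symmetricHerglotz_im_nonneg {c : ℝ} (hc : 0 ≤ c) (m : Measure ℝ) [IsFiniteMeasure m] {z : ℂ}
    (hz : 0 < z.im) : 0 ≤ (symmetricHerglotz c m z).im := by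
  rw [symmetricHerglotz_im c m hz]
  exact add_nonneg (by positivity) (integral_nonneg fun x => symmetricKernel_im_nonneg hz x)

lemma symmetricHerglotz_neg_conj (c : ℝ) (m : Measure ℝ) (z : ℂ) :
    symmetricHerglotz c m (-conj z) = -conj (symmetricHerglotz c m z) := by
  rw [symmetricHerglotz, symmetricHerglotz, map_add, neg_add, ← integral_conj, ← integral_neg]
  congr 1
  · simp
  · congr 1
    ext x
    simp [symmetricKernel, neg_div]

/-! ### Comparison with the principal value -/

lemma abs_div_sub_inv_le {a δ : ℝ} (hδ : 0 < δ) (ha : δ ≤ |a|) :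
    |a / (a ^ 2 + δ ^ 2) - a⁻¹| ≤ δ / (a ^ 2 + δ ^ 2) := by
  have ha0 : 0 < |a| := hδ.trans_le ha
  have h0 : a ≠ 0 := abs_pos.1 ha0
  have h1 : a / (a ^ 2 + δ ^ 2) - a⁻¹ = -(δ / a * (δ / (a ^ 2 + δ ^ 2))) := by field_simp; ring
  rw [h1, abs_neg, abs_mul, abs_of_nonneg (by positivity : 0 ≤ δ / (a ^ 2 + δ ^ 2)), abs_div,
    abs_of_pos hδ]
  exact mul_le_of_le_one_left (by positivity) ((div_le_one ha0).2 ha)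

/-- The truncated principal value kernel differs from the real part of the symmetric Herglotz
kernel by at most a multiple of its imaginary part. -/
lemma abs_symmetricKernel_re_sub_le {p δ x : ℝ} (hδ : 0 < δ) (hp : δ ≤ p) (hx : 0 ≤ x) :
    |(symmetricKernel (p + δ * I) x).re -
      {y : ℝ | 0 ≤ y ∧ δ < |y - p|}.indicator (fun y => (1 + y ^ 2) * (p / (y ^ 2 - p ^ 2))) x| ≤
      3 * (symmetricKernel (p + δ * I) x).im := by
  have hz : 0 < ((p : ℂ) + δ * I).im := by simpa using hδ
  rw [symmetricKernel_re hz, symmetricKernel_im hz]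
  simp only [add_re, ofReal_re, mul_re, I_re, mul_zero, ofReal_im, I_im, mul_one, sub_self,
    add_zero, add_im, mul_im, zero_add]
  have hb0 : 0 < x + p := by linarith
  have hb := abs_div_sub_inv_le (a := x + p) hδ (by rw [abs_of_pos hb0]; linarith)
  have hB : 0 ≤ δ / ((x + p) ^ 2 + δ ^ 2) := by positivity
  have hA : 0 ≤ δ / ((x - p) ^ 2 + δ ^ 2) := by positivity
  have hw : 0 ≤ (1 + x ^ 2) / 2 := by positivity
  by_cases hxp : δ < |x - p|
  · rw [Set.indicator_of_mem (show x ∈ {y : ℝ | 0 ≤ y ∧ δ < |y - p|} from ⟨hx, hxp⟩)]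
    have ha := abs_div_sub_inv_le (a := x - p) hδ hxp.le
    have h0 : x - p ≠ 0 := abs_pos.1 (hδ.trans hxp)
    have e : (1 + x ^ 2) * (p / (x ^ 2 - p ^ 2)) = (1 + x ^ 2) / 2 * ((x - p)⁻¹ - (x + p)⁻¹) := by
      have : x ^ 2 - p ^ 2 = (x - p) * (x + p) := by ring
      rw [this]
      field_simp
      ring
    rw [e, ← mul_sub, abs_mul, abs_of_nonneg hw, mul_left_comm]
    refine mul_le_mul_of_nonneg_left ?_ hw
    rw [abs_le] at *
    constructor <;> linarith [ha.1, ha.2, hb.1, hb.2]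
  -- In the excluded window `|x - p| ≤ δ` the two real terms are bounded by 1 and 2 times `δ / ((x -
  -- p)² + δ²)`; this case determines the constant 3.
  · rw [Set.indicator_of_notMem (fun h => hxp h.2), sub_zero, abs_mul, abs_of_nonneg hw,
      mul_left_comm]
    refine mul_le_mul_of_nonneg_left ?_ hw
    have hxp := not_lt.1 hxp
    have h1 : |(x - p) / ((x - p) ^ 2 + δ ^ 2)| ≤ δ / ((x - p) ^ 2 + δ ^ 2) := by
      rw [abs_div, abs_of_pos (by positivity : 0 < (x - p) ^ 2 + δ ^ 2)]
      gcongr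
    have h2 : (x + p) / ((x + p) ^ 2 + δ ^ 2) ≤ 2 * (δ / ((x - p) ^ 2 + δ ^ 2)) := by
      have h3 : (x - p) ^ 2 ≤ δ ^ 2 := sq_le_sq' (abs_le.1 hxp).1 (abs_le.1 hxp).2
      rw [← mul_div_assoc, div_le_div_iff₀ (by positivity) (by positivity)]
      nlinarith [mul_nonneg hx hδ.le, sq_nonneg (x + p - δ)]
    have h4 : 0 ≤ (x + p) / ((x + p) ^ 2 + δ ^ 2) := by positivity
    rw [abs_le] at *
    constructor <;> linarith [h1.1, h1.2]

/-- The measure with density `1 + x²`. -/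
noncomputable def weighted (m : Measure ℝ) : Measure ℝ :=
  m.withDensity fun x => ENNReal.ofReal (1 + x ^ 2)

lemma setIntegral_weighted (m : Measure ℝ) {s : Set ℝ} (hs : MeasurableSet s) (g : ℝ → ℝ) :
    ∫ x in s, g x ∂(weighted m) = ∫ x, s.indicator (fun y => (1 + y ^ 2) * g y) x ∂m := by
  rw [weighted, restrict_withDensity hs, integral_withDensity_eq_integral_toReal_smul
    (f := fun x : ℝ => ENNReal.ofReal (1 + x ^ 2)) (by fun_prop) (by simp), integral_indicator hs]
  refine integral_congr_ae (Eventually.of_forall fun x => ?_)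
  simp only [smul_eq_mul]
  rw [ENNReal.toReal_ofReal (by positivity)]

lemma measurableSet_truncation (p δ : ℝ) : MeasurableSet {x : ℝ | 0 ≤ x ∧ δ < |x - p|} :=
  measurableSet_Ici.inter
    (measurableSet_lt measurable_const (by fun_prop : Measurable fun x : ℝ => |x - p|))

lemma abs_symmetricHerglotz_re_sub_le {c : ℝ} (hc : 0 ≤ c) (m : Measure ℝ) [IsFiniteMeasure m]
    (hm : m (Set.Iio 0) = 0) {p δ : ℝ} (hδ : 0 < δ) (hp : δ ≤ p) :
    |(symmetricHerglotz c m (p + δ * I)).re - (c * p + ∫ x in {x : ℝ | 0 ≤ x ∧ δ < |x - p|},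
      p / (x ^ 2 - p ^ 2) ∂(weighted m))| ≤ 3 * (symmetricHerglotz c m (p + δ * I)).im := by
  have hz : 0 < ((p : ℂ) + δ * I).im := by simpa using hδ
  have hpos : ∀ᵐ x ∂m, 0 ≤ x := by
    rw [ae_iff]
    simpa [Set.Iio] using hm
  have hi := integrable_symmetricKernel m hz
  have hire : Integrable (fun x => (symmetricKernel (p + δ * I) x).re) m := hi.re
  have hiim : Integrable (fun x => (symmetricKernel (p + δ * I) x).im) m := hi.im
  rw [symmetricHerglotz_re c m hz, symmetricHerglotz_im c m hz,
    setIntegral_weighted m (measurableSet_truncation p δ)]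
  set τ := {y : ℝ | 0 ≤ y ∧ δ < |y - p|}.indicator (fun y => (1 + y ^ 2) * (p / (y ^ 2 - p ^ 2)))
  have hbd : ∀ᵐ x ∂m, ‖(symmetricKernel (p + δ * I) x).re - τ x‖ ≤
      3 * (symmetricKernel (p + δ * I) x).im := by
    filter_upwards [hpos] with x hx using abs_symmetricKernel_re_sub_le hδ hp hx
  have hτm : AEStronglyMeasurable τ m :=
    ((by fun_prop : Measurable fun y : ℝ => (1 + y ^ 2) * (p / (y ^ 2 - p ^ 2))).indicator
      (measurableSet_truncation p δ)).aestronglyMeasurable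
  -- The comparison itself makes the difference integrable, and with it the truncated kernel.
  have hdi : Integrable (fun x => (symmetricKernel (p + δ * I) x).re - τ x) m :=
    (hiim.const_mul 3).mono' (hire.1.sub hτm) hbd
  have hτi : Integrable τ m := by
    refine (hire.sub hdi).congr (Eventually.of_forall fun x => ?_)
    simp
  have h1 := norm_integral_le_of_norm_le (hiim.const_mul 3) hbd
  rw [integral_sub hire hτi, integral_const_mul, Real.norm_eq_abs] at h1
  have h2 : ((p : ℂ) + δ * I).re = p := by simp
  rw [h2, add_sub_add_left_eq_sub, mul_add]
  have : 0 ≤ 3 * (c * ((p : ℂ) + δ * I).im) := by positivity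
  linarith

/-- The principal value exists wherever the symmetric Herglotz integral has a real boundary
limit. -/
lemma isGeneratorValue_of_tendsto {c : ℝ} (hc : 0 ≤ c) (m : Measure ℝ) [IsFiniteMeasure m]
    (hm : m (Set.Iio 0) = 0) {p : ℝ} (hp : 0 < p) {w : ℂ} (hw : w.im = 0)
    (h : HasBoundaryLimit (symmetricHerglotz c m) p w) :
    IsGeneratorValue c (weighted m) p w.re := by
  have hre := (continuous_re.tendsto w).comp h
  have him := ((continuous_im.tendsto w).comp h).const_mul 3
  rw [hw, mul_zero] at him
  have hd : Tendsto (fun δ : ℝ => (symmetricHerglotz c m (p + δ * I)).re -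
      (c * p + ∫ x in {x : ℝ | 0 ≤ x ∧ δ < |x - p|}, p / (x ^ 2 - p ^ 2) ∂(weighted m)))
      (𝓝[>] 0) (𝓝 0) := by
    refine squeeze_zero_norm' ?_ him
    filter_upwards [self_mem_nhdsWithin,
      (eventually_le_nhds hp).filter_mono nhdsWithin_le_nhds] with δ (hδ : 0 < δ) hδp
    exact abs_symmetricHerglotz_re_sub_le hc m hm hδ hδp
  have := hre.sub hd
  rw [sub_zero] at this
  refine this.congr fun δ => ?_
  simp

/-! ### Lifting convergence from the unit circle -/

/-- A continuous real function on `(0, ∞)` converges at zero if its image on the unit circle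
does. -/
lemma exists_tendsto_of_tendsto_exp {g : ℝ → ℝ} (hg : ContinuousOn g (Set.Ioi 0)) {w : ℂ}
    (h : Tendsto (fun ε => exp (g ε * I)) (𝓝[>] 0) (𝓝 w)) :
    ∃ L, Tendsto g (𝓝[>] 0) (𝓝 L) := by
  have hw : ‖w‖ = 1 := by
    refine tendsto_nhds_unique h.norm ?_
    simp only [norm_exp_ofReal_mul_I]
    exact tendsto_const_nhds
  have hw0 : w ≠ 0 := norm_ne_zero_iff.1 (by rw [hw]; exact one_ne_zero)
  have hq : Tendsto (fun ε => exp (g ε * I) / w) (𝓝[>] 0) (𝓝 1) := by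
    simpa [div_self hw0] using h.div_const w
  obtain ⟨ε₀, hε₀, hs⟩ := mem_nhdsGT_iff_exists_Ioo_subset.1
    (hq.eventually (isOpen_slitPlane.mem_nhds one_mem_slitPlane))
  have hε₀ : 0 < ε₀ := hε₀
  -- Close to 0 the quotient `e^{ig} / w` lies in the slit plane, so its argument is continuous.
  -- Then `k` counts the full turns separating `g` from `arg w` plus that argument: it is continuous
  -- and integer-valued, hence constant.
  set k : ℝ → ℝ := fun ε => (g ε - w.arg - (exp (g ε * I) / w).arg) / (2 * Real.pi) with hk
  have hgc : ContinuousOn g (Set.Ioo 0 ε₀) := hg.mono Set.Ioo_subset_Ioi_self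
  have hqc : ContinuousOn (fun ε => exp (g ε * I) / w) (Set.Ioo 0 ε₀) := by fun_prop
  have hkc : ContinuousOn k (Set.Ioo 0 ε₀) := by
    have : ContinuousOn (fun ε => (exp (g ε * I) / w).arg) (Set.Ioo 0 ε₀) := fun ε hε =>
      ContinuousAt.comp_continuousWithinAt (f := fun ε => exp (g ε * I) / w)
        (continuousAt_arg (hs hε)) (hqc ε hε)
    exact ((hgc.sub continuousOn_const).sub this).div_const _
  have hkm : Set.MapsTo k (Set.Ioo 0 ε₀) (Set.range ((↑) : ℤ → ℝ)) := by
    intro ε _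
    have h1 : exp ((exp (g ε * I) / w).arg * I) = exp (g ε * I) / w := by
      have := norm_mul_exp_arg_mul_I (exp (g ε * I) / w)
      rwa [norm_div, norm_exp_ofReal_mul_I, hw, div_one, ofReal_one, one_mul] at this
    have h2 : exp (w.arg * I) = w := by
      have := norm_mul_exp_arg_mul_I w
      rwa [hw, ofReal_one, one_mul] at this
    have h3 : exp ((g ε - w.arg - (exp (g ε * I) / w).arg : ℂ) * I) = 1 := by
      rw [sub_mul, sub_mul, Complex.exp_sub, Complex.exp_sub, h1, h2]
      exact div_self (div_ne_zero (exp_ne_zero _) hw0)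
    obtain ⟨n, hn⟩ := exp_eq_one_iff.1 h3
    refine ⟨n, ?_⟩
    have h4 : ((g ε - w.arg - (exp (g ε * I) / w).arg : ℝ) : ℂ) = ((n * (2 * Real.pi) : ℝ) : ℂ) := by
      push_cast
      refine mul_right_cancel₀ I_ne_zero ?_
      rw [hn]; ring
    rw [ofReal_inj] at h4
    rw [hk]
    simp only
    rw [h4, mul_div_cancel_right₀ _ (by positivity)]
  have hdisc : DiscreteTopology (Set.range ((↑) : ℤ → ℝ)) :=
    Int.isClosedEmbedding_coe_real.isEmbedding.toHomeomorph.symm.isEmbedding.discreteTopology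
  have hmid : ε₀ / 2 ∈ Set.Ioo 0 ε₀ := ⟨by positivity, by linarith⟩
  have harg : Tendsto (fun ε => (exp (g ε * I) / w).arg) (𝓝[>] 0) (𝓝 0) := by
    have := (continuousAt_arg one_mem_slitPlane).tendsto.comp hq
    rwa [arg_one] at this
  refine ⟨2 * Real.pi * k (ε₀ / 2) + w.arg + 0, (tendsto_const_nhds.add harg).congr' ?_⟩
  filter_upwards [Ioo_mem_nhdsGT hε₀] with ε hε
  rw [isPreconnected_Ioo.constant_of_mapsTo ⟨hdisc⟩ hkc hkm hmid hε, hk]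
  field_simp
  ring

/-! ### Passage between `m` and `ν`, and singularity -/

lemma weighted_withDensity (m : Measure ℝ) :
    (weighted m).withDensity (fun x : ℝ => ENNReal.ofReal (1 + x ^ 2)⁻¹) = m := by
  have h : ∀ x : ℝ, ENNReal.ofReal (1 + x ^ 2)⁻¹ = (ENNReal.ofReal (1 + x ^ 2))⁻¹ := fun x =>
    ENNReal.ofReal_inv_of_pos (by positivity)
  simp_rw [h]
  refine withDensity_inv_same (by fun_prop) (Eventually.of_forall fun x => ?_)
    (Eventually.of_forall fun x => ENNReal.ofReal_ne_top)
  rw [ENNReal.ofReal_ne_zero_iff]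
  positivity

lemma weighted_of_withDensity (ν : Measure ℝ) :
    weighted (ν.withDensity (fun x : ℝ => ENNReal.ofReal (1 + x ^ 2)⁻¹)) = ν := by
  have h : ∀ x : ℝ, ENNReal.ofReal (1 + x ^ 2) = (ENNReal.ofReal (1 + x ^ 2)⁻¹)⁻¹ := fun x => by
    rw [ENNReal.ofReal_inv_of_pos (by positivity), inv_inv]
  rw [weighted]
  simp_rw [h]
  refine withDensity_inv_same (by fun_prop) (Eventually.of_forall fun x => ?_)
    (Eventually.of_forall fun x => ENNReal.ofReal_ne_top)
  rw [ENNReal.ofReal_ne_zero_iff]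
  positivity

lemma isGeneratorMeasure_weighted {m : Measure ℝ} [IsFiniteMeasure m] (h0 : m (Set.Iio 0) = 0)
    (hs : m ⟂ₘ volume) : IsGeneratorMeasure (weighted m) where
  support := withDensity_absolutelyContinuous _ _ h0
  finite := by rw [weighted_withDensity]; infer_instance
  singular := by rwa [weighted_withDensity]

lemma herglotzKernel_apply_neg (p δ x : ℝ) :
    herglotzKernel (p + δ * I) (-x) = herglotzKernel ((-p : ℝ) + δ * I) x := by
  simp [herglotzKernel]
  ring

lemma symmetricHerglotz_im_vertical (c : ℝ) (m : Measure ℝ) [IsFiniteMeasure m] (p : ℝ) {δ : ℝ}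
    (hδ : 0 < δ) : (symmetricHerglotz c m (p + δ * I)).im = c * δ +
      (∫ x, herglotzKernel (p + δ * I) x ∂m + ∫ x, herglotzKernel ((-p : ℝ) + δ * I) x ∂m) / 2 := by
  have hz : 0 < ((p : ℂ) + δ * I).im := by simpa using hδ
  have hz' : 0 < (((-p : ℝ) : ℂ) + δ * I).im := by simpa using hδ
  rw [symmetricHerglotz_im c m hz, ← integral_add (integrable_herglotzKernel m hz)
    (integrable_herglotzKernel m hz'), ← integral_div]
  congr 1
  · simp
  · congr 1
    ext x
    rw [symmetricKernel_im_eq_herglotzKernel hz, herglotzKernel_apply_neg]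

/-- The imaginary part is `c δ` plus the mean of the Herglotz integrals at `p` and `-p`, both of
which vanish in the limit for almost every `p`. -/
lemma ae_tendsto_symmetricHerglotz_im (c : ℝ) {m : Measure ℝ} [IsFiniteMeasure m]
    (hs : m ⟂ₘ volume) : ∀ᵐ p : ℝ,
      Tendsto (fun δ : ℝ => (symmetricHerglotz c m (p + δ * I)).im) (𝓝[>] 0) (𝓝 0) := by
  have h1 := ae_tendsto_integral_div_sq_add_sq_zero m hs
  filter_upwards [h1, ae_comp_neg h1] with p hp hp'
  have h0 : Tendsto (fun δ : ℝ => c * δ) (𝓝[>] 0) (𝓝 (c * 0)) :=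
    ((continuous_const_mul c).tendsto 0).mono_left nhdsWithin_le_nhds
  have h2 := h0.add (((tendsto_integral_herglotzKernel m hp).add
    (tendsto_integral_herglotzKernel m hp')).div_const 2)
  simp only [mul_zero, add_zero, zero_div] at h2
  refine h2.congr' ?_
  filter_upwards [self_mem_nhdsWithin] with δ (hδ : 0 < δ)
  rw [symmetricHerglotz_im_vertical c m p hδ]

/-- As `1 + x² ≥ 1` and the other terms are nonnegative, twice the imaginary part dominates the
Poisson integral of `m`. -/
lemma mutuallySingular_of_ae_tendsto_symmetricHerglotz_im {c : ℝ} (hc : 0 ≤ c) {m : Measure ℝ}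
    [IsFiniteMeasure m] (h : ∀ᵐ p : ℝ,
      Tendsto (fun δ : ℝ => (symmetricHerglotz c m (p + δ * I)).im) (𝓝[>] 0) (𝓝 0)) :
    m ⟂ₘ volume := by
  refine mutuallySingular_of_ae_tendsto_zero m ?_
  filter_upwards [h] with p hp
  have h2 := hp.const_mul 2
  rw [mul_zero] at h2
  refine squeeze_zero' ?_ ?_ h2
  · filter_upwards [self_mem_nhdsWithin] with δ (hδ : 0 < δ)
    exact integral_nonneg fun x => by positivity
  · filter_upwards [self_mem_nhdsWithin] with δ (hδ : 0 < δ)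
    have hz : 0 < ((p : ℂ) + δ * I).im := by simpa using hδ
    have hz' : 0 < (((-p : ℝ) : ℂ) + δ * I).im := by simpa using hδ
    rw [symmetricHerglotz_im_vertical c m p hδ]
    have h3 : ∫ x, δ / ((x - p) ^ 2 + δ ^ 2) ∂m ≤ ∫ x, herglotzKernel (p + δ * I) x ∂m := by
      refine integral_mono (integrable_div_sq_add_sq m p hδ δ) (integrable_herglotzKernel m hz)
        fun x => ?_
      simp only [herglotzKernel, add_re, add_im, mul_re, mul_im, ofReal_re, ofReal_im, I_re, I_im,
        mul_zero, mul_one, zero_add, add_zero, sub_zero]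
      gcongr
      nlinarith [mul_nonneg hδ.le (sq_nonneg x)]
    have h4 : 0 ≤ ∫ x, herglotzKernel ((-p : ℝ) + δ * I) x ∂m :=
      integral_nonneg (herglotzKernel_nonneg hz')
    have h5 : 0 ≤ c * δ := by positivity
    linarith

/-! ### From Herglotz integrals to generators and semigroups -/

/-- A symmetric Herglotz integral whose imaginary part vanishes at the boundary is a generator as
soon as its exponential has boundary values. -/
lemma isGenerator_of_eqOn {f : ℂ → ℂ} {c : ℝ} (hc : 0 ≤ c) {m : Measure ℝ} [IsFiniteMeasure m]
    (h0 : m (Set.Iio 0) = 0)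
    (hf : Set.EqOn f (symmetricHerglotz c m) UpperHalfPlane.upperHalfPlaneSet)
    (him : ∀ᵐ p : ℝ, Tendsto (fun δ : ℝ => (f (p + δ * I)).im) (𝓝[>] 0) (𝓝 0))
    (hexp : ∀ᵐ p : ℝ, ∃ w, HasBoundaryLimit (fun z => exp (I * f z)) p w) :
    IsGenerator f c (weighted m) := by
  have hd : DifferentiableOn ℂ f UpperHalfPlane.upperHalfPlaneSet :=
    (differentiableOn_symmetricHerglotz c m).congr hf
  have hmem : ∀ (p : ℝ) {ε : ℝ}, 0 < ε → (p : ℂ) + ε * I ∈ UpperHalfPlane.upperHalfPlaneSet :=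
    fun p ε hε => by
      show 0 < ((p : ℂ) + ε * I).im
      simpa using hε
  have hlim : ∀ᵐ p : ℝ, ∃ L : ℝ, HasBoundaryLimit f p L := by
    filter_upwards [him, hexp] with p hp ⟨w, hw⟩
    have hvc : ContinuousOn (fun ε : ℝ => f (p + ε * I)) (Set.Ioi 0) :=
      hd.continuousOn.comp (by fun_prop) fun ε hε => hmem p hε
    -- Here `e^{i Re f} = e^{if} · e^{Im f}`, and the second factor tends to 1.
    have h1 : Tendsto (fun ε : ℝ => exp ((f (p + ε * I)).re * I)) (𝓝[>] 0) (𝓝 (w * exp (0 : ℝ))) := by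
      refine (Tendsto.mul hw ((continuous_exp.comp continuous_ofReal).tendsto 0 |>.comp hp)).congr
        fun ε => ?_
      simp only [Function.comp_apply]
      rw [← Complex.exp_add]
      congr 1
      linear_combination (-I) * re_add_im (f (p + ε * I)) + ((f (p + ε * I)).im : ℂ) * I_sq
    obtain ⟨L, hL⟩ := exists_tendsto_of_tendsto_exp (continuous_re.comp_continuousOn hvc) h1
    refine ⟨L, ?_⟩
    have h2 := ((continuous_ofReal.tendsto L).comp hL).add
      (((continuous_ofReal.tendsto 0).comp hp).mul_const I)
    rw [ofReal_zero, zero_mul, add_zero] at h2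
    refine h2.congr fun ε => ?_
    simp only [Function.comp_apply]
    exact re_add_im _
  -- The comparison with the truncated integral requires `δ ≤ p`, so the null set `p = 0` is
  -- discarded.
  have hne : ∀ᵐ p : ℝ, p ≠ 0 := by
    rw [ae_iff]
    simp
  refine ⟨hd, fun z hz => ?_, ?_, ?_, ?_, ?_⟩
  · rw [hf hz]
    exact symmetricHerglotz_im_nonneg hc m hz
  · filter_upwards [hlim] with p ⟨L, hL⟩
    rwa [hL.boundaryValue_eq]
  · filter_upwards [hlim] with p ⟨L, hL⟩
    rw [hL.boundaryValue_eq, ofReal_im]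
  · filter_upwards [hlim] with p ⟨L, hL⟩
    -- The reflection `z ↦ -z̄` carries the vertical ray above `p` to the one above `-p`.
    have h1 : HasBoundaryLimit f (-p) (-conj (L : ℂ)) := by
      refine (((continuous_conj.tendsto _).comp hL).neg).congr' ?_
      filter_upwards [self_mem_nhdsWithin] with ε (hε : 0 < ε)
      have h2 : ((-p : ℝ) : ℂ) + ε * I = -conj ((p : ℂ) + ε * I) := by simp [add_comm]
      rw [Function.comp_apply, hf (hmem p hε), hf (hmem (-p) hε), h2, symmetricHerglotz_neg_conj]
    rw [hL.boundaryValue_eq, h1.boundaryValue_eq, conj_ofReal]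
  · filter_upwards [hlim, hne] with p ⟨L, hL⟩ hp0 hp
    rw [hL.boundaryValue_eq]
    refine isGeneratorValue_of_tendsto hc m h0 (lt_of_le_of_ne hp hp0.symm) (ofReal_im L) ?_
    refine Tendsto.congr' ?_ hL
    filter_upwards [self_mem_nhdsWithin] with ε (hε : 0 < ε)
    exact hf (hmem p hε)

lemma norm_exp_I_mul_ofReal_mul_le_one (t : ℝ≥0) {w : ℂ} (hw : 0 ≤ w.im) :
    ‖exp (I * ((t : ℝ) : ℂ) * w)‖ ≤ 1 := by
  rw [norm_exp, Real.exp_le_one_iff]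
  simp
  positivity

/-- The Herglotz integral of `m = (1 + x²)⁻¹ ν` works: singularity makes its imaginary part vanish
at the boundary, and Fatou's theorem applies to the bounded function `e^{if}`. -/
theorem exists_isGenerator {c : ℝ} (hc : 0 ≤ c) {ν : Measure ℝ} (hν : IsGeneratorMeasure ν) :
    ∃ f, IsGenerator f c ν := by
  set m := ν.withDensity (fun x : ℝ => ENNReal.ofReal (1 + x ^ 2)⁻¹) with hm
  have : IsFiniteMeasure m := hν.finite
  have h0 : m (Set.Iio 0) = 0 := withDensity_absolutelyContinuous _ _ hν.support
  refine ⟨symmetricHerglotz c m, ?_⟩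
  rw [← weighted_of_withDensity ν]
  refine isGenerator_of_eqOn hc h0 (fun _ _ => rfl) (ae_tendsto_symmetricHerglotz_im c hν.singular) ?_
  have hd := differentiableOn_symmetricHerglotz c m
  have hF := ae_hasBoundaryLimit_of_bounded (F := fun z => exp (I * symmetricHerglotz c m z)) (M := 1)
    (by fun_prop) fun z hz => by
      simpa using norm_exp_I_mul_ofReal_mul_le_one 1 (symmetricHerglotz_im_nonneg hc m hz)
  filter_upwards [hF] with p hp using ⟨_, hp⟩

theorem IsGenerator.isSymmetricInnerSemigroup {f : ℂ → ℂ} {c : ℝ} {ν : Measure ℝ}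
    (hf : IsGenerator f c ν) :
    IsSymmetricInnerSemigroup (fun (t : ℝ≥0) (z : ℂ) => exp (I * ((t : ℝ) : ℂ) * f z)) := by
  have hd := hf.holomorphic
  have hde : ∀ t : ℝ≥0, DifferentiableOn ℂ (fun z => exp (I * ((t : ℝ) : ℂ) * f z))
      UpperHalfPlane.upperHalfPlaneSet := fun t => by fun_prop
  have hb : ∀ t : ℝ≥0, ∀ᵐ p : ℝ, HasBoundaryLimit (fun z => exp (I * ((t : ℝ) : ℂ) * f z)) p
      (exp (I * ((t : ℝ) : ℂ) * boundaryValue f p)) := by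
    intro t
    filter_upwards [hf.boundary_limit] with p hp
    exact (continuous_exp.tendsto _).comp (Tendsto.const_mul (I * ((t : ℝ) : ℂ)) hp)
  have hbv : ∀ t : ℝ≥0, ∀ᵐ p : ℝ, boundaryValue (fun z => exp (I * ((t : ℝ) : ℂ) * f z)) p =
      exp (I * ((t : ℝ) : ℂ) * boundaryValue f p) := fun t => by
    filter_upwards [hb t] with p hp using hp.boundaryValue_eq
  have hl : ∀ t : ℝ≥0, ∀ᵐ p : ℝ, HasBoundaryLimit (fun z => exp (I * ((t : ℝ) : ℂ) * f z)) p
      (boundaryValue (fun z => exp (I * ((t : ℝ) : ℂ) * f z)) p) := fun t => by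
    filter_upwards [hb t] with p hp
    rwa [hp.boundaryValue_eq]
  have hn : ∀ t : ℝ≥0, ∀ᵐ p : ℝ, ‖boundaryValue (fun z => exp (I * ((t : ℝ) : ℂ) * f z)) p‖ = 1 := by
    intro t
    filter_upwards [hbv t, hf.boundary_real] with p hp hr
    rw [hp, norm_exp]
    simp [hr]
  refine ⟨fun t => ⟨hde t, ⟨1, fun z hz => ?_⟩, hl t, hn t⟩, fun t => ?_, fun s t z _ => ?_,
    fun g hg => ?_⟩
  · exact norm_exp_I_mul_ofReal_mul_le_one t (hf.im_nonneg z hz)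
  · filter_upwards [hbv t, ae_comp_neg (hbv t), hf.boundary_real, hf.boundary_odd] with p h1 h2 h3 h4
    rw [h1, h2, h4, ← exp_conj, map_mul, map_mul, conj_I, conj_ofReal, conj_eq_iff_im.2 h3]
    congr 1
    ring
  · rw [← Complex.exp_add]
    congr 1
    push_cast
    ring
  · have he : ∀ t : ℝ≥0, ∫ p : ℝ, boundaryValue (fun z => exp (I * ((t : ℝ) : ℂ) * f z)) p * g p =
        ∫ p : ℝ, exp (I * ((t : ℝ) : ℂ) * boundaryValue f p) * g p := fun t =>
      integral_congr_ae (by filter_upwards [hbv t] with p hp; rw [hp])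
    simp only [he]
    have hm := aestronglyMeasurable_boundaryValue hd hf.boundary_limit
    refine continuous_of_dominated (bound := fun p => ‖g p‖) (fun t => ?_) (fun t => ?_) hg.norm ?_
    · exact (continuous_exp.comp_aestronglyMeasurable (hm.const_mul _)).mul hg.1
    · filter_upwards [hf.boundary_real] with p hr
      rw [norm_mul]
      exact mul_le_of_le_one_left (norm_nonneg _) (norm_exp_I_mul_ofReal_mul_le_one t hr.ge)
    · exact Eventually.of_forall fun p => by fun_prop

/-! ### The exponent of a semigroup -/

/-- The Laplace transform at one of a function on `[0, ∞)`. -/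
noncomputable def laplaceOne (u : ℝ≥0 → ℂ) : ℂ :=
  ∫ s in Set.Ioi (0 : ℝ), (Real.exp (-s) : ℂ) * u s.toNNReal

lemma integrableOn_exp_neg_mul {u : ℝ≥0 → ℂ} (hu : Continuous u) (hb : ∀ t, ‖u t‖ ≤ 1) :
    IntegrableOn (fun s : ℝ => (Real.exp (-s) : ℂ) * u s.toNNReal) (Set.Ioi 0) := by
  refine (integrableOn_exp_neg_Ioi 0).ofReal.mul_bdd (c := 1) ?_ (Eventually.of_forall fun s => hb _)
  exact (hu.comp continuous_real_toNNReal).aestronglyMeasurable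

/-- A bounded continuous semigroup of complex numbers is an exponential, whose exponent is
determined by its Laplace transform. -/
lemma eq_exp_of_continuous_semigroup {u : ℝ≥0 → ℂ} (hu : Continuous u) (hb : ∀ t, ‖u t‖ ≤ 1)
    (hadd : ∀ s t, u (s + t) = u s * u t) (h0 : u 0 = 1) :
    laplaceOne u ≠ 0 ∧ ∀ t : ℝ≥0, u t = exp ((1 - 1 / laplaceOne u) * (t : ℝ)) := by
  set h : ℝ → ℂ := fun s => (Real.exp (-s) : ℂ) * u s.toNNReal with hh
  have hhc : Continuous h := by
    have := hu.comp continuous_real_toNNReal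
    exact (by fun_prop : Continuous fun s : ℝ => (Real.exp (-s) : ℂ)).mul this
  have hhi : IntegrableOn h (Set.Ioi 0) := integrableOn_exp_neg_mul hu hb
  set R := laplaceOne u with hR
  set B : ℝ → ℂ := fun t => ∫ s in (0 : ℝ)..t, h s with hB
  have hBd : ∀ t, HasDerivAt B (h t) t := fun t => hhc.integral_hasStrictDerivAt 0 t |>.hasDerivAt
  -- The left side is the tail `∫_t^∞ h`; shifting by `t` and using the semigroup law factors it.
  have key : ∀ t : ℝ, 0 ≤ t → R - B t = (Real.exp (-t) : ℂ) * u t.toNNReal * R := by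
    intro t ht
    have h1 : ∫ s in Set.Ioi (0 : ℝ), h (s + t) = ∫ s in Set.Ioi t, h s := by
      have := (measurePreserving_add_right volume t).setIntegral_preimage_emb
        (measurableEmbedding_addRight t) h (Set.Ioi t)
      rw [← this]
      congr 2
      ext s
      simp
    have h2 : ∫ s in Set.Ioi (0 : ℝ), h (s + t) = (Real.exp (-t) : ℂ) * u t.toNNReal * R := by
      rw [hR, laplaceOne, ← integral_const_mul]
      refine setIntegral_congr_fun measurableSet_Ioi fun s hs => ?_
      have hs : 0 < s := hs
      simp only [hh]
      rw [Real.toNNReal_add hs.le ht, hadd, neg_add, Real.exp_add]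
      push_cast
      ring
    have h3 : R - ∫ s in Set.Ioi t, h s = B t := intervalIntegral.integral_Ioi_sub_Ioi hhi ht
    rw [← h2, h1, ← h3, sub_sub_cancel]
  -- If `R = 0`, then `B` vanishes on `[0, ∞)`, contradicting `B'(0) = h(0) = 1`.
  have hR0 : R ≠ 0 := by
    intro hR0
    have h1 : ∀ t ∈ Set.Ici (0 : ℝ), B t = (0 : ℂ) := fun t ht => by
      simpa [hR0] using key t ht
    have h2 : HasDerivWithinAt B 0 (Set.Ici 0) 0 :=
      (hasDerivWithinAt_const (0 : ℝ) (Set.Ici (0 : ℝ)) (0 : ℂ)).congr h1 (h1 0 Set.self_mem_Ici)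
    have h3 := (uniqueDiffWithinAt_Ici (0 : ℝ)).eq_deriv _ h2 (hBd 0).hasDerivWithinAt
    simp [hh, h0] at h3
  refine ⟨hR0, fun t => ?_⟩
  set a := 1 - 1 / R with ha
  -- By `key`, `W t = e^{-at} u(t) R` for `t ≥ 0`, but in this form `W` is visibly differentiable.
  -- As `(1 - a) R = 1`, its derivative vanishes on `[0, ∞)`.
  set W : ℝ → ℂ := fun t => exp (t - a * t) * (R - B t) with hW
  have hWd : ∀ s : ℝ, HasDerivAt W
      (exp (s - a * s) * (1 - a) * (R - B s) + exp (s - a * s) * (0 - h s)) s := by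
    intro s
    have h1 : HasDerivAt (fun s : ℝ => exp ((s : ℂ) - a * s)) (exp (s - a * s) * (1 - a)) s := by
      have h2 : HasDerivAt (fun s : ℝ => (s : ℂ) - a * s) (1 - a) s := by
        have h3 : HasDerivAt (fun s : ℝ => (s : ℂ)) 1 s := ofRealCLM.hasDerivAt
        have h4 := h3.sub (h3.const_mul a)
        rw [mul_one] at h4
        exact h4
      exact h2.cexp
    exact h1.mul ((hasDerivAt_const s R).sub (hBd s))
  have hconst := constant_of_has_deriv_right_zero (f := W) (a := 0) (b := t)
    (fun s _ => (hWd s).continuousAt.continuousWithinAt) (fun s hs => by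
      have h1 := (hWd s).hasDerivWithinAt (s := Set.Ici s)
      convert h1 using 1
      rw [key s hs.1, ha]
      simp only [hh]
      field_simp
      ring) t (Set.right_mem_Icc.2 t.2)
  have hW0 : W 0 = R := by simp [hW, hB]
  rw [hW0] at hconst
  have ht := key t t.2
  rw [Real.toNNReal_coe] at ht
  simp only [hW, ht] at hconst
  have h5 : exp ((t : ℝ) - a * (t : ℝ)) * (Real.exp (-t) : ℂ) = exp (-(a * (t : ℝ))) := by
    push_cast
    rw [← Complex.exp_add]
    congr 1
    ring
  have h6 : exp (-(a * (t : ℝ))) * u t = 1 := by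
    rw [← h5]
    refine mul_right_cancel₀ hR0 ?_
    rw [one_mul]
    linear_combination hconst
  rw [Complex.exp_neg, inv_mul_eq_one₀ (exp_ne_zero _)] at h6
  exact h6.symm

/-- The Poisson kernel is an `L¹` test function, and pairing with it is evaluation at `z`. -/
lemma IsSymmetricInnerSemigroup.continuous_apply {φ : ℝ≥0 → ℂ → ℂ} (h : IsSymmetricInnerSemigroup φ)
    {z : ℂ} (hz : 0 < z.im) : Continuous fun t => φ t z := by
  refine (h.weakStar_continuous (fun t => halfPlanePoisson z t)
    (integrable_halfPlanePoisson hz).ofReal).congr fun t => ?_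
  rw [← (h.inner t).integral_halfPlanePoisson_mul hz]
  simp only [mul_comm]

/-- Idempotence leaves only the values 0 and 1, also in the boundary limit, where modulus one
excludes 0; the Poisson formula carries the value 1 inside. -/
lemma IsSymmetricInnerSemigroup.apply_zero {φ : ℝ≥0 → ℂ → ℂ} (h : IsSymmetricInnerSemigroup φ)
    {z : ℂ} (hz : 0 < z.im) : φ 0 z = 1 := by
  have hid : ∀ z ∈ UpperHalfPlane.upperHalfPlaneSet, φ 0 z = 0 ∨ φ 0 z = 1 := fun z hz => by
    have := h.add 0 0 z hz
    rw [add_zero] at this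
    by_cases h0 : φ 0 z = 0
    · exact Or.inl h0
    · exact Or.inr (mul_left_cancel₀ h0 (by rw [← this, mul_one]))
  have hbv : ∀ᵐ p : ℝ, boundaryValue (φ 0) p = 1 := by
    filter_upwards [(h.inner 0).boundary_limit, (h.inner 0).boundary_norm] with p hp hn
    have hcl : IsClosed ({0, 1} : Set ℂ) := (Set.toFinite _).isClosed
    have hmem : boundaryValue (φ 0) p ∈ ({0, 1} : Set ℂ) := by
      refine hcl.mem_of_tendsto hp ?_
      filter_upwards [self_mem_nhdsWithin] with ε (hε : 0 < ε)
      exact hid _ (show 0 < ((p : ℂ) + ε * I).im by simpa using hε)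
    rcases hmem with h0 | h1
    · rw [h0, norm_zero] at hn
      exact absurd hn zero_ne_one
    · exact h1
  rw [← (h.inner 0).integral_halfPlanePoisson_mul hz]
  have : ∫ t : ℝ, (halfPlanePoisson z t : ℂ) * boundaryValue (φ 0) t =
      ∫ t : ℝ, (halfPlanePoisson z t : ℂ) := integral_congr_ae (by
    filter_upwards [hbv] with p hp
    rw [hp, mul_one])
  rw [this, integral_complex_ofReal, integral_halfPlanePoisson hz, ofReal_one]

lemma mem_upperHalfPlaneSet_of_mem_closedBall {z w : ℂ} {r : ℝ} (hr : r < z.im)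
    (hw : w ∈ Metric.closedBall z r) : 0 < w.im := by
  rw [mem_closedBall_iff_norm] at hw
  have := (abs_le.1 ((abs_im_le_norm (w - z)).trans hw)).1
  rw [sub_im] at this
  linarith

/-- The Laplace transform of a bounded family of holomorphic functions is holomorphic. -/
lemma differentiableOn_laplaceOne {φ : ℝ≥0 → ℂ → ℂ}
    (hd : ∀ t, DifferentiableOn ℂ (φ t) UpperHalfPlane.upperHalfPlaneSet)
    (hb : ∀ t, ∀ z : ℂ, 0 < z.im → ‖φ t z‖ ≤ 1)
    (hc : ∀ z : ℂ, 0 < z.im → Continuous fun t => φ t z) :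
    DifferentiableOn ℂ (fun z => laplaceOne fun t => φ t z) UpperHalfPlane.upperHalfPlaneSet := by
  intro z hz
  have hz : 0 < z.im := hz
  have hda : ∀ t, ∀ w : ℂ, 0 < w.im → HasDerivAt (φ t) (deriv (φ t) w) w := fun t w hw =>
    ((hd t).differentiableAt (UpperHalfPlane.isOpen_upperHalfPlaneSet.mem_nhds hw)).hasDerivAt
  have hball : ∀ w ∈ Metric.ball z (z.im / 2), z.im / 2 < w.im := fun w hw => by
    rw [mem_ball_iff_norm] at hw
    have := (abs_lt.1 ((abs_im_le_norm (w - z)).trans_lt hw)).1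
    rw [sub_im] at this
    linarith
  have hmeas : ∀ w : ℂ, 0 < w.im → AEStronglyMeasurable
      (fun s : ℝ => (Real.exp (-s) : ℂ) * φ s.toNNReal w) (volume.restrict (Set.Ioi 0)) := fun w hw =>
    (integrableOn_exp_neg_mul (hc w hw) fun t => hb t w hw).1
  have := hasDerivAt_integral_of_dominated_loc_of_deriv_le (μ := volume.restrict (Set.Ioi (0 : ℝ)))
    (F := fun w s => (Real.exp (-s) : ℂ) * φ s.toNNReal w)
    (F' := fun w s => (Real.exp (-s) : ℂ) * deriv (φ s.toNNReal) w)
    (bound := fun s => Real.exp (-s) * (1 / (z.im / 3))) (x₀ := z)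
    (Metric.ball_mem_nhds z (half_pos hz)) ?_
    (integrableOn_exp_neg_mul (hc z hz) fun t => hb t z hz) ?_ ?_ ?_ ?_
  · exact this.2.differentiableAt.differentiableWithinAt
  · filter_upwards [Metric.ball_mem_nhds z (half_pos hz)] with w hw
    exact hmeas w (by linarith [hball w hw])
  -- Measurability in `s` of the complex derivative at `z`: it is a limit of difference quotients
  -- with steps `1 / (n + 1)`.
  · refine aestronglyMeasurable_of_tendsto_ae atTop (f := fun (n : ℕ) (s : ℝ) =>
      (((1 / ((n : ℝ) + 1) : ℝ) : ℂ))⁻¹ * ((Real.exp (-s) : ℂ) *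
        φ s.toNNReal (z + ((1 / ((n : ℝ) + 1) : ℝ) : ℂ)) - (Real.exp (-s) : ℂ) * φ s.toNNReal z))
      (fun n => ((hmeas _ (by simpa using hz)).sub (hmeas z hz)).const_mul _)
      (Eventually.of_forall fun s => ?_)
    have hu : Tendsto (fun n : ℕ => ((1 / ((n : ℝ) + 1) : ℝ) : ℂ)) atTop (𝓝[≠] 0) := by
      refine tendsto_nhdsWithin_iff.2 ⟨?_, Eventually.of_forall fun n => ?_⟩
      · exact (continuous_ofReal.tendsto 0).comp tendsto_one_div_add_atTop_nhds_zero_nat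
      · exact ofReal_ne_zero.2 (by positivity)
    refine (((hda s.toNNReal z hz).tendsto_slope_zero.comp hu).const_mul _).congr fun n => ?_
    simp only [Function.comp_apply, smul_eq_mul]
    ring
  · refine Eventually.of_forall fun s w hw => ?_
    rw [norm_mul, norm_real, Real.norm_of_nonneg (Real.exp_pos _).le]
    refine mul_le_mul_of_nonneg_left ?_ (Real.exp_pos _).le
    -- Cauchy's estimate on a circle of radius `Im z / 3`, which stays in the half-plane because `Im
    -- w > Im z / 2`.
    have hr : z.im / 3 < w.im := by linarith [hball w hw]
    refine norm_deriv_le_of_forall_mem_sphere_norm_le (by positivity) ?_ fun y hy =>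
      hb _ y (mem_upperHalfPlaneSet_of_mem_closedBall hr (Metric.sphere_subset_closedBall hy))
    refine DifferentiableOn.diffContOnCl ((hd _).mono ?_)
    rw [closure_ball _ (by positivity)]
    exact fun y hy => mem_upperHalfPlaneSet_of_mem_closedBall hr hy
  · exact (integrableOn_exp_neg_Ioi 0).mul_const _
  · exact Eventually.of_forall fun s w hw => (hda _ w (by linarith [hball w hw])).const_mul _

/-- A semigroup of symmetric inner functions has a holomorphic generator with non-negative
imaginary part. -/
theorem IsSymmetricInnerSemigroup.exists_exponent {φ : ℝ≥0 → ℂ → ℂ}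
    (h : IsSymmetricInnerSemigroup φ) :
    ∃ f : ℂ → ℂ, DifferentiableOn ℂ f UpperHalfPlane.upperHalfPlaneSet ∧
      (∀ z ∈ UpperHalfPlane.upperHalfPlaneSet, 0 ≤ (f z).im) ∧
      (∀ z ∈ UpperHalfPlane.upperHalfPlaneSet, f (-conj z) = -conj (f z)) ∧
      ∀ (t : ℝ≥0), ∀ z ∈ UpperHalfPlane.upperHalfPlaneSet,
        φ t z = exp (I * ((t : ℝ) : ℂ) * f z) := by
  have hb : ∀ t, ∀ z : ℂ, 0 < z.im → ‖φ t z‖ ≤ 1 := fun t z hz => (h.inner t).norm_le_one hz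
  have hc : ∀ z : ℂ, 0 < z.im → Continuous fun t => φ t z := fun z hz => h.continuous_apply hz
  have hexp : ∀ z : ℂ, 0 < z.im → _ := fun z hz => eq_exp_of_continuous_semigroup (hc z hz)
    (fun t => hb t z hz) (fun s t => h.add s t z hz) (h.apply_zero hz)
  have hL := differentiableOn_laplaceOne (fun t => (h.inner t).holomorphic) hb hc
  have hφ : ∀ (t : ℝ≥0), ∀ z ∈ UpperHalfPlane.upperHalfPlaneSet, φ t z =
      exp (I * ((t : ℝ) : ℂ) * (-I * (1 - 1 / laplaceOne fun t => φ t z))) := fun t z hz => by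
    rw [(hexp z hz).2 t]
    congr 1
    linear_combination (((t : ℝ) : ℂ) * (1 - 1 / laplaceOne fun t => φ t z)) * I_sq
  refine ⟨fun z => -I * (1 - 1 / laplaceOne fun t => φ t z), ?_, fun z hz => ?_, fun z hz => ?_, hφ⟩
  · exact ((differentiableOn_const _).sub ((differentiableOn_const _).div hL fun z hz =>
      (hexp z hz).1)).const_mul _
  · have h1 := hb 1 z hz
    rw [hφ 1 z hz, norm_exp, Real.exp_le_one_iff] at h1
    simpa only [NNReal.coe_one, ofReal_one, mul_one, I_mul_re, Left.neg_nonpos_iff] using h1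
  · have h1 : (laplaceOne fun t => φ t (-conj z)) = conj (laplaceOne fun t => φ t z) := by
      rw [laplaceOne, laplaceOne, ← integral_conj]
      congr 1
      ext s
      rw [(h.inner _).apply_neg_conj (h.symmetric _) hz, map_mul, conj_ofReal]
    simp only [h1, map_mul, map_neg, map_sub, map_div₀, map_one, conj_I]
    ring

/-! ### Symmetric Herglotz representation -/

/-- Open mapping theorem: an open image would contain points with nonzero imaginary part. -/
lemma eq_const_of_im_eq_zero {g : ℂ → ℂ} (hg : DifferentiableOn ℂ g UpperHalfPlane.upperHalfPlaneSet)
    (h0 : ∀ z ∈ UpperHalfPlane.upperHalfPlaneSet, (g z).im = 0) :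
    ∃ w, ∀ z ∈ UpperHalfPlane.upperHalfPlaneSet, g z = w := by
  have ho := UpperHalfPlane.isOpen_upperHalfPlaneSet
  refine ((hg.analyticOnNhd ho).is_constant_or_isOpen
    (convex_halfSpace_im_gt 0).isPreconnected).resolve_right fun h => ?_
  have h1 := h _ subset_rfl ho
  have hI : g I ∈ g '' UpperHalfPlane.upperHalfPlaneSet :=
    ⟨I, show 0 < I.im by simp, rfl⟩
  obtain ⟨ε, hε, hs⟩ := Metric.isOpen_iff.1 h1 _ hI
  obtain ⟨z, hz, hzε⟩ := hs (show g I + ((ε / 2 : ℝ) : ℂ) * I ∈ Metric.ball (g I) ε by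
    rw [mem_ball_iff_norm, add_sub_cancel_left, norm_mul, norm_I, mul_one, norm_real,
      Real.norm_of_nonneg (by positivity)]
    linarith)
  have h2 := h0 z hz
  rw [hzε, add_im, h0 I (show 0 < I.im by simp)] at h2
  simp at h2
  linarith

/-- The symmetric Herglotz representation. -/
theorem exists_symmetricHerglotz {f : ℂ → ℂ}
    (hf : DifferentiableOn ℂ f UpperHalfPlane.upperHalfPlaneSet)
    (him : ∀ z ∈ UpperHalfPlane.upperHalfPlaneSet, 0 ≤ (f z).im)
    (hs : ∀ z ∈ UpperHalfPlane.upperHalfPlaneSet, f (-conj z) = -conj (f z)) :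
    ∃ (c : ℝ) (m : Measure ℝ), 0 ≤ c ∧ IsFiniteMeasure m ∧ m (Set.Iio 0) = 0 ∧
      Set.EqOn f (symmetricHerglotz c m) UpperHalfPlane.upperHalfPlaneSet := by
  obtain ⟨c, μ, hc, hμ, h⟩ := exists_herglotz_representation hf him
  -- Averaging the Herglotz formula over `z` and `-z̄` symmetrises the kernel in `x`, so only the
  -- image of `μ` under `|x|` matters.
  set m := μ.map (fun x => |x|) with hm
  have hma : Measurable fun x : ℝ => |x| := by fun_prop
  have hmf : IsFiniteMeasure m := inferInstance
  have hm0 : m (Set.Iio 0) = 0 := by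
    rw [hm, Measure.map_apply hma measurableSet_Iio]
    convert measure_empty (μ := μ)
    ext x
    simp
  refine ⟨c, m, hc, hmf, hm0, ?_⟩
  have himeq : ∀ z ∈ UpperHalfPlane.upperHalfPlaneSet,
      (f z - symmetricHerglotz c m z).im = 0 := by
    intro z hz
    have hz0 : 0 < z.im := hz
    have hz' : 0 < (-conj z).im := by simpa using hz0
    have h1 := h z hz
    have h2 := h (-conj z) hz'
    rw [hs z hz] at h2
    simp only [neg_im, conj_im, neg_neg] at h2
    have hcont : Continuous fun x => (symmetricKernel z x).im :=
      continuous_im.comp (continuous_symmetricKernel hz0)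
    have h3 : ∫ x, (symmetricKernel z x).im ∂m =
        (∫ x, herglotzKernel z x ∂μ + ∫ x, herglotzKernel (-conj z) x ∂μ) / 2 := by
      rw [hm, integral_map hma.aemeasurable hcont.aestronglyMeasurable,
        ← integral_add (integrable_herglotzKernel μ hz0) (integrable_herglotzKernel μ hz'),
        ← integral_div]
      congr 1
      ext x
      have h4 : symmetricKernel z |x| = symmetricKernel z x := by
        unfold symmetricKernel
        rw [← ofReal_pow, sq_abs, ofReal_pow]
      have h5 : herglotzKernel (-conj z) x = herglotzKernel z (-x) := by
        simp only [herglotzKernel, neg_im, conj_im, neg_neg, neg_re, conj_re, even_two,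
          Even.neg_pow]
        congr 2
        ring
      rw [h4, h5, symmetricKernel_im_eq_herglotzKernel hz0]
    rw [sub_im, symmetricHerglotz_im c m hz0, h3]
    linarith
  -- Equal imaginary parts leave a real constant; at the fixed point `I` of `z ↦ -z̄` symmetry makes
  -- both functions purely imaginary, so the constant is 0.
  obtain ⟨w, hw⟩ := eq_const_of_im_eq_zero
    (hf.sub (differentiableOn_symmetricHerglotz c m)) himeq
  have hI : I ∈ UpperHalfPlane.upperHalfPlaneSet := show 0 < I.im by simp
  have hcI : -conj I = I := by simp
  have h1 : (f I).re = 0 := by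
    have := congrArg re (hs I hI)
    rw [hcI] at this
    simp at this
    linarith
  have h2 : (symmetricHerglotz c m I).re = 0 := by
    have := congrArg re (symmetricHerglotz_neg_conj c m I)
    rw [hcI] at this
    simp at this
    linarith
  have hw0 : w = 0 := by
    rw [← hw I hI]
    refine Complex.ext ?_ (himeq I hI)
    rw [Pi.sub_apply, sub_re, h1, h2]
    simp
  intro z hz
  have := hw z hz
  rwa [hw0, Pi.sub_apply, sub_eq_zero] at this

/-! ### Generators of semigroups, and the theorem -/

theorem IsSymmetricInnerSemigroup.exists_isGenerator {φ : ℝ≥0 → ℂ → ℂ}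
    (h : IsSymmetricInnerSemigroup φ) :
    ∃ (f : ℂ → ℂ) (c : ℝ) (ν : Measure ℝ), 0 ≤ c ∧ IsGeneratorMeasure ν ∧ IsGenerator f c ν ∧
      ∀ (t : ℝ≥0), ∀ z ∈ UpperHalfPlane.upperHalfPlaneSet,
        φ t z = exp (I * ((t : ℝ) : ℂ) * f z) := by
  obtain ⟨f, hd, him, hs, hφ⟩ := h.exists_exponent
  obtain ⟨c, m, hc, hm, hm0, hfm⟩ := exists_symmetricHerglotz hd him hs
  have hφ1 : ∀ z ∈ UpperHalfPlane.upperHalfPlaneSet, φ 1 z = exp (I * f z) := fun z hz => by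
    simpa using hφ 1 z hz
  have hmem : ∀ (p : ℝ) {ε : ℝ}, 0 < ε → (p : ℂ) + ε * I ∈ UpperHalfPlane.upperHalfPlaneSet :=
    fun p ε hε => by
      show 0 < ((p : ℂ) + ε * I).im
      simpa using hε
  -- Since `Im f = -log ‖φ_1‖`, unimodular boundary values of `φ_1` force `Im f → 0`.
  have hlim : ∀ᵐ p : ℝ, Tendsto (fun δ : ℝ => (f (p + δ * I)).im) (𝓝[>] 0) (𝓝 0) := by
    filter_upwards [(h.inner 1).boundary_limit, (h.inner 1).boundary_norm] with p hp hn
    have h1 := (hp.norm.log (by rw [hn]; exact one_ne_zero)).neg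
    rw [hn, Real.log_one, neg_zero] at h1
    refine h1.congr' ?_
    filter_upwards [self_mem_nhdsWithin] with ε (hε : 0 < ε)
    rw [hφ1 _ (hmem p hε), norm_exp, Real.log_exp, I_mul_re, neg_neg]
  have hsing : m ⟂ₘ volume := by
    refine mutuallySingular_of_ae_tendsto_symmetricHerglotz_im hc ?_
    filter_upwards [hlim] with p hp
    refine hp.congr' ?_
    filter_upwards [self_mem_nhdsWithin] with ε (hε : 0 < ε)
    rw [hfm (hmem p hε)]
  refine ⟨f, c, weighted m, hc, isGeneratorMeasure_weighted hm0 hsing,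
    isGenerator_of_eqOn hc hm0 hfm hlim ?_, hφ⟩
  filter_upwards [(h.inner 1).boundary_limit] with p hp
  refine ⟨_, hp.congr' ?_⟩
  filter_upwards [self_mem_nhdsWithin] with ε (hε : 0 < ε)
  exact hφ1 _ (hmem p hε)

end InnerSemigroup

theorem mainTheorem12 :
    (∀ φ : ℝ≥0 → ℂ → ℂ, InnerSemigroup.IsSymmetricInnerSemigroup φ →
      ∃ (f : ℂ → ℂ) (c : ℝ) (ν : Measure ℝ),
        0 ≤ c ∧ InnerSemigroup.IsGeneratorMeasure ν ∧ InnerSemigroup.IsGenerator f c ν ∧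
        ∀ (t : ℝ≥0), ∀ z ∈ UpperHalfPlane.upperHalfPlaneSet,
          φ t z = Complex.exp (Complex.I * ((t : ℝ) : ℂ) * f z)) ∧
    (∀ (c : ℝ) (ν : Measure ℝ), 0 ≤ c → InnerSemigroup.IsGeneratorMeasure ν →
      (∃ f : ℂ → ℂ, InnerSemigroup.IsGenerator f c ν) ∧
      ∀ f : ℂ → ℂ, InnerSemigroup.IsGenerator f c ν →
        InnerSemigroup.IsSymmetricInnerSemigroup
          (fun (t : ℝ≥0) (z : ℂ) => Complex.exp (Complex.I * ((t : ℝ) : ℂ) * f z))) := by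
  exact ⟨fun φ hφ => hφ.exists_isGenerator, fun c ν hc hν =>
    ⟨InnerSemigroup.exists_isGenerator hc hν, fun f hf => hf.isSymmetricInnerSemigroup⟩⟩
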